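/- Let $p\ge 0$ be an integer and let $(Y,X^{(1)},\dots,X^{(p)})$ be a vector of square integrable real random variables with $\mathrm{Var}(Y)>0$, and let $(Y_i,X_i^{(1)},\dots,X_i^{(p)})_{i\ge 1}$ be independent copies of it. Let $\mathrm{Proj}(Y)=\alpha_0+\alpha_1X^{(1)}+\dots+\alpha_pX^{(p)}$ be the orthogonal projection in $\mathbb L^2$ of $Y$ on the space spanned by $\mathbf 1,X^{(1)},\dots,X^{(p)}$, let $\varepsilon=Y-\mathrm{Proj}(Y)$, and let $e^{(k)}$ be the difference between $X^{(k)}$ and its orthogonal projection in $\mathbb L^2$ on the space spanned by $\mathbf 1$ and $Y$. Put $$R^2=\frac{\mathrm{Var}(\mathrm{Proj}(Y))}{\mathrm{Var}(Y)},\qquad \theta_k=\frac{\mathrm{Cov}(Y,X^{(k)})}{\mathrm{Var}(Y)},\qquad (\mathbf M_0)_{j,\ell}=\mathrm{Cov}(X^{(j)},X^{(\ell)})\quad(1\le j,k,\ell\le p).$$ For $z\in\mathbb R^n$ let $\mathrm{Var}_n(z)=\frac1n\sum_{i=1}^n(z_i-\bar z)^2$. Let $\mathbf Y=(Y_1,\dots,Y_n)^t$,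 let $\Pi$ be the orthogonal projection of $\mathbb R^n$ on the span of $(1,\dots,1)^t$ and of the vectors $(X^{(j)}_1,\dots,X^{(j)}_n)^t$, $1\le j\le p$, and put $\widehat R^2=\mathrm{Var}_n(\Pi\mathbf Y)/\mathrm{Var}_n(\mathbf Y)$ (with the convention $\widehat R^2=0$ when $\mathrm{Var}_n(\mathbf Y)=0$). Assume that $\mathbf M_0$ is invertible and that, for all $1\le j\le p$, $\mathbb E\big((X^{(j)}-\mathbb E X^{(j)})^2\varepsilon^2\big)<\infty$ and $\mathbb E\big((Y-\mathbb E Y)^2(e^{(j)})^2\big)<\infty$. Let $\mathbf A$ be the symmetric $2p\times 2p$ matrix with, for $1\le j,k\le p$, $$\mathbf A_{j,k}=\mathbb E\big((X^{(j)}-\mathbb EX^{(j)})(X^{(k)}-\mathbb EX^{(k)})\varepsilon^2\big),\quad \mathbf A_{p+j,p+k}=\mathbb E\big((Y-\mathbb EY)^2e^{(j)}e^{(k)}\big),$$ $$\mathbf A_{j,p+k}=\mathbb E\big((X^{(j)}-\mathbb EX^{(j)})(Y-\mathbb EY)\,\varepsilon\, e^{(k)}\big),$$ let $\mathbf B$ be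 the block diagonal $2p\times 2p$ matrix with blocks $\mathbf M_0^{-1}$ and $\mathrm{Var}(Y)^{-1}I_p$, and let $$V=(\theta_1,\dots,\theta_p,\alpha_1,\dots,\alpha_p)\,\mathbf B\mathbf A\mathbf B\,(\theta_1,\dots,\theta_p,\alpha_1,\dots,\alpha_p)^t.$$ (1) If $R^2=1$, then $V=0$, and almost surely $\widehat R^2=1$ for every $n$ such that $\mathrm{Var}_n(\mathbf Y)>0$; moreover, almost surely, $\mathrm{Var}_n(\mathbf Y)>0$, and hence $\widehat R^2=1$, for all $n$ large enough. (2) If $R^2=0$, then $V=0$, the matrix $\mathbf B\mathbf A\mathbf B$ is positive semidefinite, and $n\widehat R^2$ converges in distribution, as $n\to\infty$, to $(G_1,\dots,G_p)(G_{p+1},\dots,G_{2p})^t=\sum_{j=1}^pG_jG_{p+j}$, where $(G_1,\dots,G_{2p})$ is a centered Gaussian vector with covariance matrix $\mathbf B\mathbf A\mathbf B$. (3) If $R^2>0$ and the family consisting of $(Y-\mathbb EY)^2$, of the $(Y-\mathbb EY)(X^{(j)}-\mathbb EX^{(j)})$, $1\le j\le p$, and of the $(X^{(i)}-\mathbb EX^{(i)})(X^{(j)}-\mathbb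 EX^{(j)})$, $1\le i\le j\le p$, is linearly independent (no linear combination of its members with a nonzero coefficient vanishes almost surely), then $V>0$. -/

import Mathlib

open MeasureTheory ProbabilityTheory Filter Topology

noncomputable section

/-! ### Orthogonal projection in `L²` on the space spanned by `1` and a finite family -/

/-- The family `Z` together with the constant variable `1` (at the index `none`). -/
def withOne {Ω ι : Type*} (Z : ι → Ω → ℝ) : Option ι → Ω → ℝ
  | none => fun _ => 1
  | some i => Z i

theorem memLp_withOne {Ω ι : Type*} [MeasurableSpace Ω] {P : Measure Ω} [IsProbabilityMeasure P]
    {Z : ι → Ω → ℝ} (hZ : ∀ i, MemLp (Z i) 2 P) (o : Option ι) : MemLp (withOne Z o) 2 P := by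
  cases o with
  | none => exact memLp_const 1
  | some i => exact hZ i

/-- The members of the family `1, Z i` as vectors of `L²(P)`. -/
def withOneL2 {Ω ι : Type*} [MeasurableSpace Ω] {P : Measure Ω} [IsProbabilityMeasure P]
    {Z : ι → Ω → ℝ} (hZ : ∀ i, MemLp (Z i) 2 P) (o : Option ι) : Lp ℝ 2 P :=
  (memLp_withOne hZ o).toLp (withOne Z o)

instance instHasOrthogonalProjectionSpanRange {E ι : Type*} [NormedAddCommGroup E]
    [InnerProductSpace ℝ E] [Finite ι] (f : ι → E) :
    (Submodule.span ℝ (Set.range f)).HasOrthogonalProjection :=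
  haveI : FiniteDimensional ℝ (Submodule.span ℝ (Set.range f)) :=
    FiniteDimensional.span_of_finite ℝ (Set.finite_range f)
  inferInstance

/-- The orthogonal projection, in `L²(P)`, of `U` on the space spanned by `1` and the `Z i`. -/
def projL2 {Ω ι : Type*} [MeasurableSpace Ω] {P : Measure Ω} [IsProbabilityMeasure P] [Fintype ι]
    {Z : ι → Ω → ℝ} {U : Ω → ℝ} (hZ : ∀ i, MemLp (Z i) 2 P) (hU : MemLp U 2 P) : Lp ℝ 2 P :=
  (Submodule.span ℝ (Set.range (withOneL2 hZ))).starProjection (hU.toLp U)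

theorem exists_projL2_coeff {Ω ι : Type*} [MeasurableSpace Ω] {P : Measure Ω}
    [IsProbabilityMeasure P] [Fintype ι] {Z : ι → Ω → ℝ} {U : Ω → ℝ}
    (hZ : ∀ i, MemLp (Z i) 2 P) (hU : MemLp U 2 P) :
    ∃ c : Option ι → ℝ, ∑ o, c o • withOneL2 hZ o = projL2 hZ hU :=
  (Submodule.mem_span_range_iff_exists_fun ℝ).1 (Submodule.starProjection_apply_mem _ _)

/-- Coefficients of `projL2 hZ hU` on the family `1, Z i`; they are unique as soon as this family
is linearly independent in `L²(P)`. -/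
def projCoeff {Ω ι : Type*} [MeasurableSpace Ω] {P : Measure Ω} [IsProbabilityMeasure P] [Fintype ι]
    {Z : ι → Ω → ℝ} {U : Ω → ℝ} (hZ : ∀ i, MemLp (Z i) 2 P) (hU : MemLp U 2 P) : Option ι → ℝ :=
  Classical.choose (exists_projL2_coeff hZ hU)

/-- Linear independence of a finite family of (a.s. classes of) random variables. -/
def LinIndepAS {Ω ι : Type*} [MeasurableSpace Ω] [Fintype ι] (P : Measure Ω)
    (F : ι → Ω → ℝ) : Prop :=
  ∀ c : ι → ℝ, (∀ᵐ ω ∂P, ∑ i, c i * F i ω = 0) → c = 0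

/-! ### Population quantities -/

/-- The multiple correlation coefficient `R² = Var(Proj_V Y) / Var Y`, where `V` is spanned by
`1, X 1, …, X p`. -/
def popR2 {Ω : Type*} [MeasurableSpace Ω] {P : Measure Ω} [IsProbabilityMeasure P] {p : ℕ}
    {Y : Ω → ℝ} {X : Fin p → Ω → ℝ} (hY : MemLp Y 2 P) (hX : ∀ j, MemLp (X j) 2 P) : ℝ :=
  Var[fun ω => projL2 hX hY ω; P] / Var[Y; P]

/-- The residual `ε = Y - Proj_V Y`. -/
def resY {Ω : Type*} [MeasurableSpace Ω] {P : Measure Ω} [IsProbabilityMeasure P] {p : ℕ}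
    {Y : Ω → ℝ} {X : Fin p → Ω → ℝ} (hY : MemLp Y 2 P) (hX : ∀ j, MemLp (X j) 2 P) : Ω → ℝ :=
  fun ω => Y ω - projL2 hX hY ω

/-- The residual `e⁽ᵏ⁾ = X k - Proj_W (X k)`, where `W` is spanned by `1` and `Y`. -/
def resX {Ω : Type*} [MeasurableSpace Ω] {P : Measure Ω} [IsProbabilityMeasure P] {p : ℕ}
    {Y : Ω → ℝ} {X : Fin p → Ω → ℝ} (hY : MemLp Y 2 P) (hX : ∀ j, MemLp (X j) 2 P)
    (k : Fin p) : Ω → ℝ :=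
  fun ω => X k ω - projL2 (Z := fun _ : Unit => Y) (fun _ => hY) (hX k) ω

/-- The coefficients `α 1, …, α p` of `Proj_V Y = α 0 + α 1 X 1 + ⋯ + α p X p`. -/
def popAlpha {Ω : Type*} [MeasurableSpace Ω] {P : Measure Ω} [IsProbabilityMeasure P] {p : ℕ}
    {Y : Ω → ℝ} {X : Fin p → Ω → ℝ} (hY : MemLp Y 2 P) (hX : ∀ j, MemLp (X j) 2 P) : Fin p → ℝ :=
  fun j => projCoeff hX hY (some j)

/-- `θ k = Cov(Y, X k) / Var Y`. -/
def popTheta {Ω : Type*} [MeasurableSpace Ω] (P : Measure Ω) {p : ℕ}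
    (Y : Ω → ℝ) (X : Fin p → Ω → ℝ) : Fin p → ℝ :=
  fun k => cov[Y, X k; P] / Var[Y; P]

/-- The covariance matrix `M₀` of `(X 1, …, X p)`. -/
def covX {Ω : Type*} [MeasurableSpace Ω] (P : Measure Ω) {p : ℕ}
    (X : Fin p → Ω → ℝ) : Matrix (Fin p) (Fin p) ℝ :=
  Matrix.of fun j l => cov[X j, X l; P]

/-- The `2p × 2p` matrix `A`; the index set `{1, …, 2p}` is written `Fin p ⊕ Fin p`. -/
def matA {Ω : Type*} [MeasurableSpace Ω] {P : Measure Ω} [IsProbabilityMeasure P] {p : ℕ}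
    {Y : Ω → ℝ} {X : Fin p → Ω → ℝ} (hY : MemLp Y 2 P) (hX : ∀ j, MemLp (X j) 2 P) :
    Matrix (Fin p ⊕ Fin p) (Fin p ⊕ Fin p) ℝ :=
  let A₁₂ : Matrix (Fin p) (Fin p) ℝ := Matrix.of fun j k =>
    ∫ ω, (X j ω - P[X j]) * (Y ω - P[Y]) * resY hY hX ω * resX hY hX k ω ∂P
  Matrix.fromBlocks
    (Matrix.of fun j k => ∫ ω, (X j ω - P[X j]) * (X k ω - P[X k]) * resY hY hX ω ^ 2 ∂P)
    A₁₂
    A₁₂.transpose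
    (Matrix.of fun j k => ∫ ω, (Y ω - P[Y]) ^ 2 * resX hY hX j ω * resX hY hX k ω ∂P)

/-- The `2p × 2p` matrix `B`, block diagonal with blocks `M₀⁻¹` and `(Var Y)⁻¹ I`. -/
def matB {Ω : Type*} [MeasurableSpace Ω] (P : Measure Ω) {p : ℕ}
    (Y : Ω → ℝ) (X : Fin p → Ω → ℝ) : Matrix (Fin p ⊕ Fin p) (Fin p ⊕ Fin p) ℝ :=
  Matrix.fromBlocks (covX P X)⁻¹ 0 0 ((Var[Y; P])⁻¹ • (1 : Matrix (Fin p) (Fin p) ℝ))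

/-- The matrix `B A B`. -/
def matBAB {Ω : Type*} [MeasurableSpace Ω] {P : Measure Ω} [IsProbabilityMeasure P] {p : ℕ}
    {Y : Ω → ℝ} {X : Fin p → Ω → ℝ} (hY : MemLp Y 2 P) (hX : ∀ j, MemLp (X j) 2 P) :
    Matrix (Fin p ⊕ Fin p) (Fin p ⊕ Fin p) ℝ :=
  matB P Y X * matA hY hX * matB P Y X

/-- `V = (θ, α) B A B (θ, α)ᵗ`. -/
def asymVar {Ω : Type*} [MeasurableSpace Ω] {P : Measure Ω} [IsProbabilityMeasure P] {p : ℕ}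
    {Y : Ω → ℝ} {X : Fin p → Ω → ℝ} (hY : MemLp Y 2 P) (hX : ∀ j, MemLp (X j) 2 P) : ℝ :=
  dotProduct (Sum.elim (popTheta P Y X) (popAlpha hY hX))
    ((matBAB hY hX).mulVec (Sum.elim (popTheta P Y X) (popAlpha hY hX)))

/-- The family consisting of `(Y - E Y)²`, of the `(Y - E Y)(X j - E X j)`, and of the
`(X i - E X i)(X j - E X j)` with `i ≤ j`. -/
def centeredProducts {Ω : Type*} [MeasurableSpace Ω] (P : Measure Ω) {p : ℕ}
    (Y : Ω → ℝ) (X : Fin p → Ω → ℝ) :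
    Unit ⊕ Fin p ⊕ {q : Fin p × Fin p // q.1 ≤ q.2} → Ω → ℝ
  | Sum.inl _ => fun ω => (Y ω - P[Y]) ^ 2
  | Sum.inr (Sum.inl j) => fun ω => (Y ω - P[Y]) * (X j ω - P[X j])
  | Sum.inr (Sum.inr q) => fun ω => (X q.1.1 ω - P[X q.1.1]) * (X q.1.2 ω - P[X q.1.2])

/-! ### Empirical quantities -/

/-- The empirical variance `n⁻¹ ∑ (z i - z̄)²`. -/
def empVar {n : ℕ} (z : EuclideanSpace ℝ (Fin n)) : ℝ :=
  (n : ℝ)⁻¹ * ∑ i, (z i - (n : ℝ)⁻¹ * ∑ k, z k) ^ 2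

/-- `R̂² = Var_n (Π y) / Var_n y`, where `Π` is the orthogonal projection of `ℝⁿ` on the span of
`(1, …, 1)` and of the vectors `x 1, …, x p`. -/
def empR2 {n p : ℕ} (y : EuclideanSpace ℝ (Fin n)) (x : Fin p → EuclideanSpace ℝ (Fin n)) : ℝ :=
  empVar ((Submodule.span ℝ
    (insert (WithLp.toLp 2 fun _ => (1 : ℝ)) (Set.range x))).starProjection y) / empVar y

/-- The vector of the first `n` terms of a sequence of random variables. -/
def sampleVec {Ω : Type*} (Z : ℕ → Ω → ℝ) (n : ℕ) (ω : Ω) : EuclideanSpace ℝ (Fin n) :=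
  WithLp.toLp 2 fun i => Z i ω

/-- `R̂²` computed from the first `n` terms of the sample `(Yᵢ, Xᵢ)`. -/
def sampleR2 {Ω : Type*} {p : ℕ} (Ys : ℕ → Ω → ℝ) (Xs : ℕ → Fin p → Ω → ℝ) (n : ℕ) (ω : Ω) : ℝ :=
  empR2 (sampleVec Ys n ω) (fun j => sampleVec (fun i => Xs i j) n ω)

end

/-! Write `T` for the centered projection `explained` and `Yc = Y - E Y`. The matrix `A` is the
second moment matrix of the vector `score`, which the moment hypotheses place in L². Hence `BAB` is
positive semidefinite, and `V` is the second moment of one linear combination of the scores. The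
normal equations `M₀ α = Var(Y) θ` show that `B` sends `(θ, α)` to `(α, α) / Var(Y)`, so this
combination is `(2 T Yc - T² - R² Yc²) / Var(Y)` (`sum_matB_mulVec_mul_score`). All claims on `V`
follow: `T = Yc` almost surely when `R² = 1`, `T = 0` when `R² = 0`, and otherwise `Yc²` has the
nonzero coefficient `-R²` in an expression that is linear in the centered products.

If `R² = 1`, `Y` is almost surely an affine function of the `X j`. The sample inherits this
relation, and the strong law makes the empirical variance of `Y` eventually positive.

If `R² = 0`, the normal equations in `ℝⁿ` give `n R̂² = (√n c)ᵗ Mₙ⁻¹ (√n c) / Varₙ(Y)`, where `c`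
collects the empirical covariances of `Y` with the `X j`. Up to a negligible product of means, `√n
c` is the normalized sum `z` of the vectors `Xc Yc`. In this case `Xc Yc` is centered and both
halves of the score equal it, so `B (z, z)` converges to a Gaussian vector of covariance `BAB`
(`tendstoInDistribution_sum_influence`). The law of large numbers for `Mₙ` and `Varₙ(Y)`, with
Slutsky's lemma applied to `statMap`, concludes. -/

/-! ### Empirical covariances and the empirical multiple correlation coefficient -/

/-! ### Measurability of projections on random spans -/

section Measurability

open scoped RealInnerProductSpace

variable {E : Type*} [NormedAddCommGroup E] [InnerProductSpace ℝ E] [FiniteDimensional ℝ E]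

/-- One step of the Gram–Schmidt procedure for projections on spans. -/
theorem starProjection_span_insert (v : E) (S : Set E) (y : E) :
    (Submodule.span ℝ (insert v S)).starProjection y =
      (Submodule.span ℝ S).starProjection y +
        (⟪v - (Submodule.span ℝ S).starProjection v, y⟫ /
          ⟪v - (Submodule.span ℝ S).starProjection v,
            v - (Submodule.span ℝ S).starProjection v⟫) •
          (v - (Submodule.span ℝ S).starProjection v) := by
  set K := Submodule.span ℝ S with hK
  set r := v - K.starProjection v with hr
  set c := ⟪r, y⟫ / ⟪r, r⟫ with hc
  have hle : K ≤ Submodule.span ℝ (insert v S) := Submodule.span_mono (Set.subset_insert _ _)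
  -- If `r = 0` the quotient is `0` by convention and both sides vanish, so `v` already lying in the
  -- span needs no separate treatment.
  have hcr : c * ⟪r, r⟫ = ⟪r, y⟫ := by
    by_cases h : r = 0
    · simp [h]
    · rw [hc, div_mul_cancel₀]
      simpa using h
  have hrK : ∀ w ∈ K, ⟪r, w⟫ = 0 := fun w hw => Submodule.starProjection_inner_eq_zero v w hw
  have hyK : ∀ w ∈ K, ⟪y - K.starProjection y, w⟫ = 0 :=
    fun w hw => Submodule.starProjection_inner_eq_zero y w hw
  have hoK : ∀ w ∈ K, ⟪y - (K.starProjection y + c • r), w⟫ = 0 := fun w hw => by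
    rw [← sub_sub, inner_sub_left, hyK w hw, real_inner_smul_left, hrK w hw]
    simp
  have hor : ⟪y - (K.starProjection y + c • r), r⟫ = 0 := by
    rw [← sub_sub, inner_sub_left, inner_sub_left, real_inner_smul_left, hcr,
      real_inner_comm r (K.starProjection y), hrK _ (Submodule.starProjection_apply_mem K y),
      real_inner_comm]
    simp
  apply Submodule.eq_starProjection_of_mem_of_inner_eq_zero
  · refine Submodule.add_mem _ (hle (Submodule.starProjection_apply_mem K y))
      (Submodule.smul_mem _ _ (Submodule.sub_mem _ ?_
        (hle (Submodule.starProjection_apply_mem K v))))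
    exact Submodule.subset_span (Set.mem_insert _ _)
  · intro w hw
    obtain ⟨a, z, hz, rfl⟩ := Submodule.mem_span_insert.1 hw
    have hv : v = r + K.starProjection v := by simp [hr]
    rw [inner_add_right, real_inner_smul_right, hoK z hz, hv, inner_add_right, hor,
      hoK _ (Submodule.starProjection_apply_mem K v)]
    simp

variable [MeasurableSpace E] [BorelSpace E]

/-- The dimension of the span may vary with `ω`, which rules out inverting a Gram matrix.
Gram–Schmidt adds one vector at a time through inner products and quotients, which are measurable
even where the denominator vanishes. -/
theorem measurable_starProjection_span_image {Ω ι : Type*} [MeasurableSpace Ω] {v : ι → Ω → E}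
    (hv : ∀ i, Measurable (v i)) (s : Finset ι) {y : Ω → E} (hy : Measurable y) :
    Measurable fun ω => (Submodule.span ℝ ((fun i => v i ω) '' s)).starProjection (y ω) := by
  classical
  induction s using Finset.induction_on generalizing y with
  | empty => simp
  | insert i s _ ih =>
    simp only [Finset.coe_insert, Set.image_insert_eq, starProjection_span_insert]
    have h₁ := ih (hv i)
    have h₂ := ih hy
    have := hv i
    fun_prop

theorem measurable_starProjection_span_range {Ω ι : Type*} [MeasurableSpace Ω] [Fintype ι]
    {v : ι → Ω → E} (hv : ∀ i, Measurable (v i)) {y : Ω → E} (hy : Measurable y) :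
    Measurable fun ω => (Submodule.span ℝ (Set.range fun i => v i ω)).starProjection (y ω) := by
  simpa using measurable_starProjection_span_image hv Finset.univ hy

end Measurability

theorem measurable_empVar {n : ℕ} : Measurable (empVar : EuclideanSpace ℝ (Fin n) → ℝ) := by
  unfold empVar
  fun_prop

theorem measurable_empR2 {Ω : Type*} [MeasurableSpace Ω] {n p : ℕ}
    {y : Ω → EuclideanSpace ℝ (Fin n)} {x : Fin p → Ω → EuclideanSpace ℝ (Fin n)}
    (hy : Measurable y) (hx : ∀ j, Measurable (x j)) :
    Measurable fun ω => empR2 (y ω) (fun j => x j ω) := by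
  have h := measurable_starProjection_span_range
    (v := fun o : Option (Fin p) => o.elim (fun _ => WithLp.toLp 2 fun _ => (1 : ℝ)) x)
    (by rintro (_ | j); exacts [measurable_const, hx j]) hy
  have hrange : ∀ ω, Set.range (fun o : Option (Fin p) =>
      o.elim (fun _ => (WithLp.toLp 2 fun _ => (1 : ℝ) : EuclideanSpace ℝ (Fin n))) x ω) =
      insert (WithLp.toLp 2 fun _ => (1 : ℝ)) (Set.range fun j => x j ω) := by
    intro ω
    ext z
    simp [Option.exists, eq_comm]
  simp only [hrange] at h
  exact (measurable_empVar.comp h).div (measurable_empVar.comp hy)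

/-! ### Normal equations for the empirical projection -/

/-- The empirical covariance `n⁻¹ ∑ uᵢ wᵢ - ū w̄`. -/
noncomputable def empCov {n : ℕ} (u w : Fin n → ℝ) : ℝ :=
  (n : ℝ)⁻¹ * ∑ i, u i * w i - ((n : ℝ)⁻¹ * ∑ i, u i) * ((n : ℝ)⁻¹ * ∑ i, w i)

theorem empVar_eq_empCov {n : ℕ} (z : EuclideanSpace ℝ (Fin n)) : empVar z = empCov z z := by
  rcases Nat.eq_zero_or_pos n with rfl | hn
  · simp [empVar, empCov]
  have hn' : (n : ℝ) ≠ 0 := by positivity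
  unfold empVar empCov
  simp only [sub_sq, Finset.sum_add_distrib, Finset.sum_sub_distrib, ← Finset.sum_mul,
    ← Finset.mul_sum, Finset.sum_const, Finset.card_univ, Fintype.card_fin, nsmul_eq_mul]
  simp only [pow_two]
  field_simp
  ring

theorem empCov_comm {n : ℕ} (u w : Fin n → ℝ) : empCov u w = empCov w u := by
  unfold empCov
  simp only [mul_comm (u _)]
  ring

theorem empCov_sub_const {n : ℕ} (u w : Fin n → ℝ) (a b : ℝ) :
    empCov (fun i => u i - a) (fun i => w i - b) = empCov u w := by
  rcases Nat.eq_zero_or_pos n with rfl | hn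
  · simp [empCov]
  have hn' : (n : ℝ) ≠ 0 := by positivity
  unfold empCov
  have h : ∀ i, (u i - a) * (w i - b) = u i * w i - a * w i - b * u i + a * b := fun i => by ring
  simp only [h, Finset.sum_add_distrib, Finset.sum_sub_distrib,
    ← Finset.mul_sum, Finset.sum_const, Finset.card_univ, Fintype.card_fin, nsmul_eq_mul]
  field_simp
  ring

theorem empCov_sum_left {n p : ℕ} (x : Fin p → Fin n → ℝ) (a : Fin p → ℝ) (w : Fin n → ℝ) :
    empCov (fun i => ∑ j, a j * x j i) w = ∑ j, a j * empCov (x j) w := by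
  have h₁ : ∑ i, (∑ j, a j * x j i) * w i = ∑ j, a j * ∑ i, x j i * w i := by
    simp only [Finset.sum_mul, Finset.mul_sum, mul_assoc]
    exact Finset.sum_comm
  have h₂ : ∑ i, ∑ j, a j * x j i = ∑ j, a j * ∑ i, x j i := by
    simp only [Finset.mul_sum]
    exact Finset.sum_comm
  unfold empCov
  rw [h₁, h₂]
  simp only [mul_sub, Finset.sum_sub_distrib]
  rw [Finset.mul_sum, Finset.mul_sum, Finset.sum_mul]
  congr 1 <;> exact Finset.sum_congr rfl fun j _ => by ring

/-- The projection of `y` on the span of `1` and of the `x j`, given by the normal equations. -/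
theorem starProjection_eq_of_normal_equations {n p : ℕ} (hn : 0 < n)
    (y : EuclideanSpace ℝ (Fin n)) (x : Fin p → EuclideanSpace ℝ (Fin n)) (a : Fin p → ℝ)
    (ha : ∀ k, ∑ j, a j * empCov (x j) (x k) = empCov y (x k)) :
    (Submodule.span ℝ
      (insert (WithLp.toLp 2 fun _ => (1 : ℝ)) (Set.range x))).starProjection y =
      ((n : ℝ)⁻¹ * ∑ i, (y i - ∑ j, a j * x j i)) • (WithLp.toLp 2 fun _ => (1 : ℝ)) +
        ∑ j, a j • x j := by
  have hn' : (n : ℝ) ≠ 0 := by positivity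
  set b := (n : ℝ)⁻¹ * ∑ i, (y i - ∑ j, a j * x j i) with hb
  set one : EuclideanSpace ℝ (Fin n) := WithLp.toLp 2 fun _ => (1 : ℝ) with hone
  have hres : ∀ i, (y - (b • one + ∑ j, a j • x j)) i = (y i - ∑ j, a j * x j i) - b := by
    intro i
    simp [hone]
    ring
  apply Submodule.eq_starProjection_of_mem_of_inner_eq_zero
  · refine Submodule.add_mem _ (Submodule.smul_mem _ _ (Submodule.subset_span
      (Set.mem_insert _ _))) (Submodule.sum_mem _ fun j _ => Submodule.smul_mem _ _
        (Submodule.subset_span (Set.mem_insert_of_mem _ (Set.mem_range_self j))))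
  · have hsum : ∑ i, ((y i - ∑ j, a j * x j i) - b) = 0 := by
      rw [Finset.sum_sub_distrib, hb]
      simp
      field_simp
      ring
    have h1 : inner ℝ (y - (b • one + ∑ j, a j • x j)) one = 0 := by
      rw [PiLp.inner_apply]
      simp only [hres]
      simpa only [hone, RCLike.inner_apply, conj_trivial, one_mul] using hsum
    have hx : ∀ k, inner ℝ (y - (b • one + ∑ j, a j • x j)) (x k) = 0 := by
      intro k
      rw [PiLp.inner_apply]
      simp only [hres, RCLike.inner_apply, conj_trivial]
      -- Since the residuals sum to zero, their inner product with `x k` is `n` times an empirical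
      -- covariance, and this covariance vanishes by the normal equations.
      have h2 : empCov (fun i => (y i - ∑ j, a j * x j i) - b) (x k) = 0 := by
        have e1 : empCov (fun i => (y i - ∑ j, a j * x j i) - b) (fun i => x k i - 0) =
            empCov y (x k) - empCov (fun i => ∑ j, a j * x j i) (x k) := by
          rw [empCov_sub_const]
          unfold empCov
          simp only [sub_mul, Finset.sum_sub_distrib, mul_sub]
          ring
        simp only [sub_zero] at e1
        rw [e1, empCov_sum_left (fun j => x j), ha k, sub_self]
      unfold empCov at h2
      rw [hsum] at h2
      simp only [mul_zero, zero_mul, sub_zero, mul_eq_zero, inv_eq_zero, hn', false_or] at h2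
      rw [← h2]
      exact Finset.sum_congr rfl fun i _ => by ring
    intro w hw
    induction hw using Submodule.span_induction with
    | mem w hw =>
      rcases hw with rfl | ⟨k, rfl⟩
      exacts [h1, hx k]
    | zero => simp
    | add u w _ _ hu hw => rw [inner_add_right, hu, hw, add_zero]
    | smul c w _ hw => rw [inner_smul_right, hw, mul_zero]

/-- If the empirical covariance matrix is invertible, then the explained empirical variance is a
quadratic form in the empirical covariances. -/
theorem empVar_starProjection {n p : ℕ} (hn : 0 < n)
    (y : EuclideanSpace ℝ (Fin n)) (x : Fin p → EuclideanSpace ℝ (Fin n))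
    (hM : IsUnit (Matrix.of fun j k => empCov (x j) (x k))) :
    empVar ((Submodule.span ℝ
      (insert (WithLp.toLp 2 fun _ => (1 : ℝ)) (Set.range x))).starProjection y) =
      (fun j => empCov y (x j)) ⬝ᵥ
        ((Matrix.of fun j k => empCov (x j) (x k))⁻¹.mulVec fun j => empCov y (x j)) := by
  set M : Matrix (Fin p) (Fin p) ℝ := Matrix.of fun j k => empCov (x j) (x k) with hMdef
  set c : Fin p → ℝ := fun j => empCov y (x j) with hc
  set a : Fin p → ℝ := M⁻¹.mulVec c with ha
  have hMa : M.mulVec a = c := by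
    rw [ha, Matrix.mulVec_mulVec, Matrix.mul_nonsing_inv _ ((Matrix.isUnit_iff_isUnit_det _).1 hM),
      Matrix.one_mulVec]
  have hnorm : ∀ k, ∑ j, a j * empCov (x j) (x k) = empCov y (x k) := by
    intro k
    rw [← show c k = empCov y (x k) from rfl, ← hMa]
    simp only [Matrix.mulVec, dotProduct, hMdef, Matrix.of_apply]
    exact Finset.sum_congr rfl fun j _ => by rw [empCov_comm, mul_comm]
  rw [starProjection_eq_of_normal_equations hn y x a hnorm, empVar_eq_empCov]
  set b := (n : ℝ)⁻¹ * ∑ i, (y i - ∑ j, a j * x j i) with hb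
  have e : (b • (WithLp.toLp 2 fun _ => (1 : ℝ) : EuclideanSpace ℝ (Fin n)) +
      ∑ j, a j • x j).ofLp = fun i => ∑ j, a j * x j i - (-b) := by
    funext i
    simp
    ring
  -- The constant does not contribute. Bilinearity leaves `aᵗ M a`, which the normal equations turn
  -- into `aᵗ c`.
  rw [e, empCov_sub_const, empCov_sum_left (fun j => x j)]
  rw [dotProduct_comm]
  simp only [dotProduct]
  refine Finset.sum_congr rfl fun j _ => ?_
  rw [empCov_comm, empCov_sum_left (fun j => x j), hnorm j]

theorem empR2_eq_one_of_mem {n p : ℕ} {y : EuclideanSpace ℝ (Fin n)}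
    {x : Fin p → EuclideanSpace ℝ (Fin n)} (b : ℝ) (a : Fin p → ℝ)
    (h : ∀ i, y i = b + ∑ j, a j * x j i) (hy : 0 < empVar y) : empR2 y x = 1 := by
  have hmem : y ∈ Submodule.span ℝ (insert (WithLp.toLp 2 fun _ => (1 : ℝ)) (Set.range x)) := by
    have e : y = b • (WithLp.toLp 2 fun _ => (1 : ℝ)) + ∑ j, a j • x j := by
      ext i
      simp [h i]
    rw [e]
    exact Submodule.add_mem _ (Submodule.smul_mem _ _ (Submodule.subset_span
      (Set.mem_insert _ _))) (Submodule.sum_mem _ fun j _ => Submodule.smul_mem _ _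
        (Submodule.subset_span (Set.mem_insert_of_mem _ (Set.mem_range_self j))))
  rw [empR2, Submodule.starProjection_eq_self_iff.2 hmem, div_self hy.ne']

/-! ### Population quantities -/

/-! ### Normal equations in `L²` -/

section Projection

variable {Ω ι : Type*} [MeasurableSpace Ω] {P : Measure Ω} [IsProbabilityMeasure P] [Fintype ι]
  {Z : ι → Ω → ℝ} {U : Ω → ℝ} (hZ : ∀ i, MemLp (Z i) 2 P) (hU : MemLp U 2 P)

theorem projL2_ae_eq_sum :
    projL2 hZ hU =ᵐ[P] fun ω => ∑ o, projCoeff hZ hU o * withOne Z o ω := by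
  have hW : ∀ o, MemLp (fun ω => projCoeff hZ hU o * withOne Z o ω) 2 P :=
    fun o => (memLp_withOne hZ o).const_mul _
  have hsum : ∀ s : Finset (Option ι), ((∑ o ∈ s, projCoeff hZ hU o • withOneL2 hZ o :
      Lp ℝ 2 P) : Ω → ℝ) =ᵐ[P] fun ω => ∑ o ∈ s, projCoeff hZ hU o * withOne Z o ω := by
    classical
    intro s
    induction s using Finset.induction_on with
    | empty =>
      filter_upwards with ω
      simp
    | insert o s ho ih =>
      rw [Finset.sum_insert ho]
      filter_upwards [ih, Lp.coeFn_add (projCoeff hZ hU o • withOneL2 hZ o)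
        (∑ o ∈ s, projCoeff hZ hU o • withOneL2 hZ o),
        Lp.coeFn_smul (projCoeff hZ hU o) (withOneL2 hZ o),
        (memLp_withOne hZ o).coeFn_toLp] with ω h₁ h₂ h₃ h₄
      rw [h₂, Pi.add_apply, h₃, h₁, Finset.sum_insert ho, Pi.smul_apply, smul_eq_mul,
        withOneL2, h₄]
  rw [← Classical.choose_spec (exists_projL2_coeff hZ hU)]
  exact hsum Finset.univ

theorem integral_sub_projL2_mul (o : Option ι) :
    ∫ ω, (U ω - projL2 hZ hU ω) * withOne Z o ω ∂P = 0 := by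
  have h : inner ℝ (hU.toLp U - projL2 hZ hU) (withOneL2 hZ o) = 0 :=
    Submodule.starProjection_inner_eq_zero _ _ (Submodule.subset_span (Set.mem_range_self o))
  rw [L2.inner_def] at h
  rw [← h]
  refine integral_congr_ae ?_
  filter_upwards [Lp.coeFn_sub (hU.toLp U) (projL2 hZ hU), hU.coeFn_toLp,
    (memLp_withOne hZ o).coeFn_toLp] with ω h₁ h₂ h₃
  rw [h₁, Pi.sub_apply, h₂, withOneL2, h₃]
  simp [mul_comm]

theorem integral_eq_sum_projCoeff :
    P[U] = projCoeff hZ hU none + ∑ i, projCoeff hZ hU (some i) * P[Z i] := by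
  have h := integral_sub_projL2_mul hZ hU none
  have e₀ := projL2_ae_eq_sum hZ hU
  generalize projCoeff hZ hU = c at *
  have hi : ∀ i, Integrable (Z i) P := fun i => (hZ i).integrable (by norm_num)
  have e : (fun ω => (U ω - projL2 hZ hU ω) * withOne Z none ω) =ᵐ[P] fun ω =>
      U ω - (c none + ∑ i, c (some i) * Z i ω) := by
    filter_upwards [e₀] with ω hω
    rw [hω, Fintype.sum_option]
    simp [withOne]
  have hs : Integrable (fun ω => ∑ i, c (some i) * Z i ω) P :=
    integrable_finsetSum _ fun i _ => (hi i).const_mul _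
  have hs' : Integrable (fun ω => c none + ∑ i, c (some i) * Z i ω) P :=
    (integrable_const _).add hs
  rw [integral_congr_ae e, integral_sub (hU.integrable (by norm_num)) hs',
    integral_add (integrable_const _) hs,
    integral_finsetSum _ fun i _ => (hi i).const_mul _] at h
  simp only [integral_const_mul, integral_const, probReal_univ, one_smul] at h
  linarith

theorem projL2_ae_eq_centered :
    projL2 hZ hU =ᵐ[P] fun ω => P[U] + ∑ i, projCoeff hZ hU (some i) * (Z i ω - P[Z i]) := by
  filter_upwards [projL2_ae_eq_sum hZ hU] with ω hω
  rw [hω, integral_eq_sum_projCoeff hZ hU, Fintype.sum_option]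
  simp only [withOne, mul_sub, Finset.sum_sub_distrib]
  ring

/-- The residual is orthogonal to `1` and to `Z j`, hence uncorrelated with `Z j`. -/
theorem sum_projCoeff_mul_covariance (j : ι) :
    ∑ i, projCoeff hZ hU (some i) * cov[Z i, Z j; P] = cov[U, Z j; P] := by
  have h₀ := integral_sub_projL2_mul hZ hU none
  have hj := integral_sub_projL2_mul hZ hU (some j)
  have e₀ := projL2_ae_eq_sum hZ hU
  generalize projCoeff hZ hU = c at *
  generalize projL2 hZ hU = W at *
  have hC : ∀ i, MemLp (fun ω => c (some i) * Z i ω) 2 P := fun i => (hZ i).const_mul _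
  have hS : MemLp (fun ω => ∑ i, c (some i) * Z i ω) 2 P := memLp_finsetSum _ fun i _ => hC i
  have e : W =ᵐ[P] fun ω => c none + ∑ i, c (some i) * Z i ω := by
    filter_upwards [e₀] with ω hω
    rw [hω, Fintype.sum_option]
    simp [withOne]
  simp only [withOne, mul_one] at h₀ hj
  have hcov : cov[fun ω => U ω - W ω, Z j; P] = 0 := by
    have hUW : MemLp (fun ω => U ω - W ω) 2 P := hU.sub (Lp.memLp W)
    rw [covariance_eq_sub hUW (hZ j), h₀, zero_mul, sub_zero]
    exact hj
  have hW : cov[W, Z j; P] = ∑ i, c (some i) * cov[Z i, Z j; P] := by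
    have h : cov[W, Z j; P] = cov[fun ω => c none + ∑ i, c (some i) * Z i ω, Z j; P] := by
      unfold covariance
      rw [integral_congr_ae e]
      refine integral_congr_ae ?_
      filter_upwards [e] with ω hω
      rw [hω]
    rw [h, covariance_const_add_left (hS.integrable (by norm_num)),
      covariance_fun_sum_left hC (hZ j)]
    simp only [covariance_const_mul_left]
  rw [covariance_fun_sub_left hU (Lp.memLp W) (hZ j), hW] at hcov
  linarith

end Projection

/-! ### Explained part, residuals and the variance `V` -/

section Population

variable {Ω : Type*} [MeasurableSpace Ω] {P : Measure Ω} [IsProbabilityMeasure P] {p : ℕ}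
  {Y : Ω → ℝ} {X : Fin p → Ω → ℝ} (hY : MemLp Y 2 P) (hX : ∀ j, MemLp (X j) 2 P)

/-- The centered projection `Proj(Y) - E Y`. -/
noncomputable def explained (ω : Ω) : ℝ := ∑ j, popAlpha hY hX j * (X j ω - P[X j])

theorem resY_ae : resY hY hX =ᵐ[P] fun ω => Y ω - P[Y] - explained hY hX ω := by
  filter_upwards [projL2_ae_eq_centered hX hY] with ω hω
  rw [resY, hω, explained]
  simp only [popAlpha]
  ring

theorem sum_popAlpha_mul_cov (k : Fin p) :
    ∑ j, popAlpha hY hX j * cov[X j, X k; P] = cov[Y, X k; P] :=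
  sum_projCoeff_mul_covariance hX hY k

theorem resX_ae (hVar : 0 < Var[Y; P]) (k : Fin p) : resX hY hX k =ᵐ[P] fun ω =>
    X k ω - P[X k] - popTheta P Y X k * (Y ω - P[Y]) := by
  have h := sum_projCoeff_mul_covariance (Z := fun _ : Unit => Y) (fun _ => hY) (hX k) ()
  simp only [Finset.univ_unique, Finset.sum_singleton, covariance_self hY.aemeasurable] at h
  have hθ : projCoeff (Z := fun _ : Unit => Y) (fun _ => hY) (hX k) (some ()) =
      popTheta P Y X k := by
    rw [popTheta, eq_div_iff hVar.ne', covariance_comm, ← h]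
  filter_upwards [projL2_ae_eq_centered (Z := fun _ : Unit => Y) (fun _ => hY) (hX k)] with ω hω
  rw [resX, hω]
  simp only [Finset.univ_unique, Finset.sum_singleton]
  rw [← hθ]
  change _ - (_ + projCoeff _ _ (some ()) * _) = _
  ring

theorem memLp_explained : MemLp (explained hY hX) 2 P :=
  memLp_finsetSum _ fun j _ => ((hX j).sub (memLp_const _)).const_mul _

theorem integral_explained : P[explained hY hX] = 0 := by
  have hi : ∀ i, Integrable (X i) P := fun i => (hX i).integrable (by norm_num)
  have hi' : ∀ j, Integrable (fun ω => popAlpha hY hX j * (X j ω - P[X j])) P :=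
    fun j => ((hi j).sub (integrable_const _)).const_mul _
  unfold explained
  rw [integral_finsetSum _ fun j _ => hi' j]
  refine Finset.sum_eq_zero fun j _ => ?_
  rw [integral_const_mul, integral_sub (hi j) (integrable_const _)]
  simp

theorem covariance_explained {U : Ω → ℝ} (hU : MemLp U 2 P) :
    cov[explained hY hX, U; P] = ∑ j, popAlpha hY hX j * cov[X j, U; P] := by
  have hX' : ∀ j, MemLp (fun ω => popAlpha hY hX j * (X j ω - P[X j])) 2 P :=
    fun j => ((hX j).sub (memLp_const _)).const_mul _
  unfold explained
  rw [covariance_fun_sum_left hX' hU]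
  refine Finset.sum_congr rfl fun j _ => ?_
  rw [covariance_const_mul_left, covariance_sub_const_left ((hX j).integrable (by norm_num))]

/-- The residual is uncorrelated with every `X k`, hence with their combination `explained`. -/
theorem cov_explained_self_eq :
    cov[explained hY hX, explained hY hX; P] = cov[Y, explained hY hX; P] := by
  have hc : ∀ {U : Ω → ℝ}, MemLp U 2 P → cov[U, explained hY hX; P] =
      ∑ j, popAlpha hY hX j * cov[U, X j; P] := fun hU => by
    rw [covariance_comm, covariance_explained hY hX hU]
    exact Finset.sum_congr rfl fun j _ => by rw [covariance_comm]
  rw [hc (memLp_explained hY hX), hc hY]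
  refine Finset.sum_congr rfl fun j _ => ?_
  rw [covariance_explained hY hX (hX j), sum_popAlpha_mul_cov]

theorem variance_explained (hVar : 0 < Var[Y; P]) :
    Var[explained hY hX; P] = popR2 hY hX * Var[Y; P] := by
  rw [popR2, div_mul_cancel₀ _ hVar.ne', variance_congr (projL2_ae_eq_centered hX hY),
    variance_const_add]
  · rfl
  · exact (memLp_explained hY hX).1

/-- Multiplied by `Var Y`, both sides become `Cov(T, Y) = Var T`, with `T` the explained part. -/
theorem sum_popAlpha_mul_popTheta (hVar : 0 < Var[Y; P]) :
    ∑ j, popAlpha hY hX j * popTheta P Y X j = popR2 hY hX := by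
  have h := variance_explained hY hX hVar
  rw [← covariance_self (memLp_explained hY hX).aemeasurable, cov_explained_self_eq,
    covariance_comm, covariance_explained hY hX hY] at h
  rw [← mul_left_inj' hVar.ne', ← h, Finset.sum_mul]
  refine Finset.sum_congr rfl fun j _ => ?_
  rw [popTheta, mul_assoc, div_mul_cancel₀ _ hVar.ne', covariance_comm]

/-- The residual variance is `(1 - R²) Var Y = 0`, so the residual is almost surely equal to its
mean. -/
theorem explained_ae_of_popR2_eq_one (hVar : 0 < Var[Y; P]) (hR : popR2 hY hX = 1) :
    explained hY hX =ᵐ[P] fun ω => Y ω - P[Y] := by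
  have hT := memLp_explained hY hX
  have h : Var[fun ω => Y ω - explained hY hX ω; P] = 0 := by
    rw [variance_fun_sub hY hT, ← cov_explained_self_eq, covariance_self hT.aemeasurable,
      variance_explained hY hX hVar, hR]
    ring
  filter_upwards [ae_eq_integral_of_variance_eq_zero (hY.sub hT) h] with ω hω
  simp only [Pi.sub_apply] at hω
  rw [integral_sub (hY.integrable (by norm_num)) (hT.integrable (by norm_num)),
    integral_explained] at hω
  linarith

theorem explained_ae_of_popR2_eq_zero (hVar : 0 < Var[Y; P]) (hR : popR2 hY hX = 0) :
    explained hY hX =ᵐ[P] 0 := by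
  have h := variance_explained hY hX hVar
  rw [hR, zero_mul] at h
  filter_upwards [ae_eq_integral_of_variance_eq_zero (memLp_explained hY hX) h] with ω hω
  rw [hω, integral_explained, Pi.zero_apply]

omit [IsProbabilityMeasure P] in
theorem covX_isSymm : (covX P X).IsSymm := by
  ext i j
  simp [covX, covariance_comm]

theorem covX_mulVec_popAlpha (hVar : 0 < Var[Y; P]) :
    (covX P X).mulVec (popAlpha hY hX) = Var[Y; P] • popTheta P Y X := by
  ext k
  rw [Pi.smul_apply, popTheta, smul_eq_mul, mul_div_cancel₀ _ hVar.ne', ← sum_popAlpha_mul_cov hY hX]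
  simp only [Matrix.mulVec, dotProduct, covX, Matrix.of_apply]
  exact Finset.sum_congr rfl fun j _ => by rw [mul_comm, covariance_comm]

theorem covX_inv_mulVec_popTheta (hVar : 0 < Var[Y; P]) (hM : IsUnit (covX P X)) :
    (covX P X)⁻¹.mulVec (popTheta P Y X) = Var[Y; P]⁻¹ • popAlpha hY hX := by
  have h : popTheta P Y X = Var[Y; P]⁻¹ • (covX P X).mulVec (popAlpha hY hX) := by
    rw [covX_mulVec_popAlpha hY hX hVar, smul_smul, inv_mul_cancel₀ hVar.ne', one_smul]
  rw [h, Matrix.mulVec_smul, Matrix.mulVec_mulVec,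
    Matrix.nonsing_inv_mul _ ((Matrix.isUnit_iff_isUnit_det _).1 hM), Matrix.one_mulVec]

omit [IsProbabilityMeasure P] in
theorem matB_isSymm : (matB P Y X).IsSymm := by
  unfold matB
  refine Matrix.IsSymm.fromBlocks ?_ (by simp) ?_
  · rw [Matrix.IsSymm, Matrix.transpose_nonsing_inv, covX_isSymm]
  · rw [Matrix.IsSymm, Matrix.transpose_smul, Matrix.transpose_one]

/-- The vector `((X j - E X j) ε, (Y - E Y) e⁽ᵏ⁾)`, whose second moment matrix is `A`. -/
noncomputable def score : Fin p ⊕ Fin p → Ω → ℝ :=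
  Sum.elim (fun j ω => (X j ω - P[X j]) * resY hY hX ω)
    (fun k ω => (Y ω - P[Y]) * resX hY hX k ω)

variable (hmom₁ : ∀ j, Integrable (fun ω => (X j ω - P[X j]) ^ 2 * resY hY hX ω ^ 2) P)
  (hmom₂ : ∀ j, Integrable (fun ω => (Y ω - P[Y]) ^ 2 * resX hY hX j ω ^ 2) P)

include hmom₁ hmom₂

theorem memLp_score (i : Fin p ⊕ Fin p) : MemLp (score hY hX i) 2 P := by
  have hp : ∀ {κ : Type} [Fintype κ] {Z : κ → Ω → ℝ} {U : Ω → ℝ} (hZ : ∀ i, MemLp (Z i) 2 P)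
      (hU : MemLp U 2 P), AEStronglyMeasurable (projL2 hZ hU) P := fun hZ hU =>
    (Lp.memLp _).1
  rcases i with j | k
  · have hm : AEStronglyMeasurable (score hY hX (Sum.inl j)) P :=
      ((hX j).1.sub aestronglyMeasurable_const).mul (hY.1.sub (hp hX hY))
    rw [memLp_two_iff_integrable_sq hm]
    simpa only [score, Sum.elim_inl, mul_pow] using hmom₁ j
  · have hm : AEStronglyMeasurable (score hY hX (Sum.inr k)) P :=
      (hY.1.sub aestronglyMeasurable_const).mul ((hX k).1.sub (hp _ (hX k)))
    rw [memLp_two_iff_integrable_sq hm]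
    simpa only [score, Sum.elim_inr, mul_pow] using hmom₂ k

omit hmom₁ hmom₂ in
theorem matA_apply (i j : Fin p ⊕ Fin p) :
    matA hY hX i j = ∫ ω, score hY hX i ω * score hY hX j ω ∂P := by
  rcases i with i | i <;> rcases j with j | j <;>
    simp only [matA, Matrix.fromBlocks_apply₁₁, Matrix.fromBlocks_apply₁₂,
      Matrix.fromBlocks_apply₂₁, Matrix.fromBlocks_apply₂₂, Matrix.of_apply,
      Matrix.transpose_apply, score, Sum.elim_inl, Sum.elim_inr] <;>
    refine integral_congr_ae (ae_of_all _ fun ω => ?_) <;> ring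

/-- `A` is the Gram matrix of the scores in L². Their products are integrable by Cauchy–Schwarz, so
sums and integral may be exchanged. -/
theorem dotProduct_matA_mulVec (u : Fin p ⊕ Fin p → ℝ) :
    u ⬝ᵥ (matA hY hX).mulVec u = ∫ ω, (∑ i, u i * score hY hX i ω) ^ 2 ∂P := by
  have hs := memLp_score hY hX hmom₁ hmom₂
  have hint : ∀ i j, Integrable (fun ω => u i * score hY hX i ω * (u j * score hY hX j ω)) P :=
    fun i j => ((hs i).const_mul (u i)).integrable_mul ((hs j).const_mul (u j))
  simp only [pow_two, Finset.sum_mul_sum]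
  rw [integral_finsetSum _ fun i _ => integrable_finsetSum _ fun j _ => hint i j]
  simp only [dotProduct, Matrix.mulVec, Finset.mul_sum]
  refine Finset.sum_congr rfl fun i _ => ?_
  rw [integral_finsetSum _ fun j _ => hint i j]
  refine Finset.sum_congr rfl fun j _ => ?_
  rw [matA_apply, ← integral_mul_const, ← integral_const_mul]
  exact integral_congr_ae (ae_of_all _ fun ω => by ring)

theorem dotProduct_matBAB_mulVec (u : Fin p ⊕ Fin p → ℝ) :
    u ⬝ᵥ (matBAB hY hX).mulVec u =
      ∫ ω, (∑ i, (matB P Y X).mulVec u i * score hY hX i ω) ^ 2 ∂P := by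
  rw [← dotProduct_matA_mulVec hY hX hmom₁ hmom₂, matBAB, ← Matrix.mulVec_mulVec,
    ← Matrix.mulVec_mulVec, Matrix.dotProduct_mulVec, ← Matrix.mulVec_transpose, matB_isSymm]

theorem posSemidef_matBAB : (matBAB hY hX).PosSemidef := by
  refine Matrix.PosSemidef.of_dotProduct_mulVec_nonneg ?_ fun u => ?_
  · have hA : (matA hY hX).transpose = matA hY hX := by
      ext i j
      rw [Matrix.transpose_apply, matA_apply, matA_apply]
      simp only [mul_comm]
    rw [Matrix.IsHermitian, Matrix.conjTranspose_eq_transpose_of_trivial, matBAB,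
      Matrix.transpose_mul, Matrix.transpose_mul, matB_isSymm, hA, Matrix.mul_assoc]
  · rw [star_trivial, dotProduct_matBAB_mulVec hY hX hmom₁ hmom₂]
    exact integral_nonneg fun ω => sq_nonneg _

omit hmom₁ hmom₂ in
-- This is the simplification behind `V`: the two blocks, weighted differently in `(θ, α)`, receive
-- the same weights after `B`.
theorem matB_mulVec_elim (hVar : 0 < Var[Y; P]) (hM : IsUnit (covX P X)) :
    (matB P Y X).mulVec (Sum.elim (popTheta P Y X) (popAlpha hY hX)) =
      Sum.elim (Var[Y; P]⁻¹ • popAlpha hY hX) (Var[Y; P]⁻¹ • popAlpha hY hX) := by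
  rw [matB, Matrix.fromBlocks_mulVec]
  simp [Matrix.smul_mulVec, covX_inv_mulVec_popTheta hY hX hVar hM]

omit hmom₁ hmom₂ in
-- With `T` the explained part and `Yc = Y - E Y`, the first block contributes `T (Yc - T)` and the
-- second `Yc (T - R² Yc)`, using `∑ αⱼ θⱼ = R²`.
theorem sum_matB_mulVec_mul_score (hVar : 0 < Var[Y; P]) (hM : IsUnit (covX P X)) :
    (fun ω => ∑ i, (matB P Y X).mulVec (Sum.elim (popTheta P Y X) (popAlpha hY hX)) i *
      score hY hX i ω) =ᵐ[P] fun ω => Var[Y; P]⁻¹ * (2 * explained hY hX ω * (Y ω - P[Y]) -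
        explained hY hX ω ^ 2 - popR2 hY hX * (Y ω - P[Y]) ^ 2) := by
  have hX' : ∀ᵐ ω ∂P, ∀ k, resX hY hX k ω =
      X k ω - P[X k] - popTheta P Y X k * (Y ω - P[Y]) := ae_all_iff.2 (resX_ae hY hX hVar)
  filter_upwards [hX', resY_ae hY hX] with ω h₁ h₂
  rw [matB_mulVec_elim hY hX hVar hM, Fintype.sum_sum_type]
  simp only [Sum.elim_inl, Sum.elim_inr, Pi.smul_apply, smul_eq_mul, score, h₁, h₂]
  have e₁ : ∑ j, Var[Y; P]⁻¹ * popAlpha hY hX j *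
      ((X j ω - P[X j]) * (Y ω - P[Y] - explained hY hX ω)) =
      Var[Y; P]⁻¹ * (explained hY hX ω * (Y ω - P[Y] - explained hY hX ω)) := by
    rw [explained, Finset.sum_mul, Finset.mul_sum]
    exact Finset.sum_congr rfl fun j _ => by ring
  have e₂ : ∑ j, Var[Y; P]⁻¹ * popAlpha hY hX j *
      ((Y ω - P[Y]) * (X j ω - P[X j] - popTheta P Y X j * (Y ω - P[Y]))) =
      Var[Y; P]⁻¹ * ((Y ω - P[Y]) * (explained hY hX ω - popR2 hY hX * (Y ω - P[Y]))) := by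
    rw [← sum_popAlpha_mul_popTheta hY hX hVar, explained, Finset.sum_mul,
      ← Finset.sum_sub_distrib, Finset.mul_sum, Finset.mul_sum]
    exact Finset.sum_congr rfl fun j _ => by ring
  rw [e₁, e₂]
  ring

theorem asymVar_eq_zero_iff (hVar : 0 < Var[Y; P]) (hM : IsUnit (covX P X)) :
    asymVar hY hX = 0 ↔ ∀ᵐ ω ∂P, 2 * explained hY hX ω * (Y ω - P[Y]) -
        explained hY hX ω ^ 2 - popR2 hY hX * (Y ω - P[Y]) ^ 2 = 0 := by
  have hs : MemLp (fun ω => ∑ i, (matB P Y X).mulVec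
      (Sum.elim (popTheta P Y X) (popAlpha hY hX)) i * score hY hX i ω) 2 P :=
    memLp_finsetSum _ fun i _ => (memLp_score hY hX hmom₁ hmom₂ i).const_mul _
  rw [asymVar, dotProduct_matBAB_mulVec hY hX hmom₁ hmom₂,
    integral_eq_zero_iff_of_nonneg (fun ω => sq_nonneg _) hs.integrable_sq]
  refine eventually_congr ?_
  filter_upwards [sum_matB_mulVec_mul_score hY hX hVar hM] with ω hω
  rw [hω]
  simp [hVar.ne']

theorem asymVar_nonneg : 0 ≤ asymVar hY hX := by
  rw [asymVar, dotProduct_matBAB_mulVec hY hX hmom₁ hmom₂]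
  exact integral_nonneg fun ω => sq_nonneg _

/-- If `V` vanished, a quadratic form in `Y - E Y` and the explained part would be almost surely
zero. Expanded, it is a linear combination of the centered products in which `(Y - E Y)²` has
coefficient `-R²`. -/
theorem asymVar_pos (hVar : 0 < Var[Y; P]) (hM : IsUnit (covX P X)) (hR : 0 < popR2 hY hX)
    (hind : LinIndepAS P (centeredProducts P Y X)) : 0 < asymVar hY hX := by
  refine (asymVar_nonneg hY hX hmom₁ hmom₂).lt_of_ne' fun h0 => hR.ne' ?_
  rw [asymVar_eq_zero_iff hY hX hmom₁ hmom₂ hVar hM] at h0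
  set α := popAlpha hY hX with hα
  -- The coefficients of `2 T Yc - T² - R² Yc²`. Each off-diagonal product occurs twice in `T²` but
  -- is listed once in the family, hence the factor `2` there.
  have hc := hind (Sum.elim (fun _ => -popR2 hY hX) (Sum.elim (fun j => 2 * α j)
    (fun q => -(if q.1.1 = q.1.2 then α q.1.1 * α q.1.2 else 2 * (α q.1.1 * α q.1.2))))) ?_
  · simpa using congrFun hc (Sum.inl ())
  · filter_upwards [h0] with ω hω
    have hsq : ∀ x : Fin p → ℝ, (∑ j, α j * x j) ^ 2 = ∑ q : {q : Fin p × Fin p // q.1 ≤ q.2},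
        (if q.1.1 = q.1.2 then α q.1.1 * α q.1.2 else 2 * (α q.1.1 * α q.1.2)) *
          (x q.1.1 * x q.1.2) := by
      intro x
      set g : Fin p × Fin p → ℝ := fun q => α q.1 * x q.1 * (α q.2 * x q.2) with hg
      -- By symmetry of `g`, the pairs below the diagonal have the same sum as those above it.
      have hswap : ∑ q : Fin p × Fin p, (if q.2 < q.1 then g q else 0) =
          ∑ q : Fin p × Fin p, (if q.1 < q.2 then g q else 0) := by
        rw [← Equiv.sum_comp (Equiv.prodComm (Fin p) (Fin p))]
        refine Finset.sum_congr rfl fun q _ => ?_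
        simp only [Equiv.prodComm_apply, Prod.fst_swap, Prod.snd_swap, hg]
        congr 1
        ring
      have hsub : ∑ q : {q : Fin p × Fin p // q.1 ≤ q.2},
          (if q.1.1 = q.1.2 then α q.1.1 * α q.1.2 else 2 * (α q.1.1 * α q.1.2)) *
          (x q.1.1 * x q.1.2) = ∑ q : Fin p × Fin p, if q.1 ≤ q.2 then
            (if q.1 = q.2 then α q.1 * α q.2 else 2 * (α q.1 * α q.2)) * (x q.1 * x q.2)
              else 0 := by
        rw [← Finset.sum_filter]
        exact (Finset.sum_subtype _ (by simp) (fun q : Fin p × Fin p =>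
          (if q.1 = q.2 then α q.1 * α q.2 else 2 * (α q.1 * α q.2)) * (x q.1 * x q.2))).symm
      rw [hsub, pow_two, Finset.sum_mul_sum, ← Fintype.sum_prod_type']
      have hsplit : ∀ q : Fin p × Fin p, g q = (if q.2 < q.1 then g q else 0) +
          (if q.1 ≤ q.2 then g q else 0) := fun q => by
        by_cases h : q.1 ≤ q.2
        · simp [h, not_lt.2 h]
        · simp [h, not_le.1 h]
      change ∑ q, g q = _
      rw [Finset.sum_congr rfl fun q _ => hsplit q, Finset.sum_add_distrib, hswap,
        ← Finset.sum_add_distrib]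
      refine Finset.sum_congr rfl fun q _ => ?_
      rcases lt_trichotomy q.1 q.2 with h | h | h
      · rw [if_pos h, if_pos h.le, if_pos h.le, if_neg h.ne, hg]
        ring
      · rw [if_neg h.not_lt, if_pos h.le, if_pos h.le, if_pos h, hg]
        ring
      · rw [if_neg h.not_gt, if_neg h.not_ge, if_neg h.not_ge, add_zero]
    rw [Fintype.sum_sum_type, Fintype.sum_sum_type]
    simp only [Finset.univ_unique, Finset.sum_singleton, Sum.elim_inl, Sum.elim_inr,
      centeredProducts, neg_mul, Finset.sum_neg_distrib]
    rw [← hsq fun j => X j ω - P[X j]]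
    have e : ∑ j, 2 * α j * ((Y ω - P[Y]) * (X j ω - P[X j])) =
        2 * explained hY hX ω * (Y ω - P[Y]) := by
      rw [explained, Finset.mul_sum, Finset.sum_mul]
      exact Finset.sum_congr rfl fun j _ => by ring
    rw [e, ← hω]
    simp only [explained, ← hα]
    ring

end Population

/-! ### Multivariate central limit theorem -/

/-- **Central limit theorem** in finite dimension. -/
theorem tendstoInDistribution_inv_sqrt_smul_sum_multivariate {Ω ι : Type*} [MeasurableSpace Ω]
    {P : Measure Ω} [IsProbabilityMeasure P] [Fintype ι] [DecidableEq ι]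
    {X : ℕ → Ω → EuclideanSpace ℝ ι} {S : Matrix ι ι ℝ} (hS : S.PosSemidef)
    (hindep : iIndepFun X P) (hident : ∀ i, IdentDistrib (X i) (X 0) P P)
    (hL2 : ∀ t, MemLp (fun ω => inner ℝ (X 0 ω) t) 2 P)
    (hmean : ∀ t, ∫ ω, inner ℝ (X 0 ω) t ∂P = 0)
    (hvar : ∀ t, Var[fun ω => inner ℝ (X 0 ω) t; P] = t ⬝ᵥ S.mulVec t) :
    TendstoInDistribution (fun (n : ℕ) ω => (√n)⁻¹ • ∑ k ∈ Finset.range n, X k ω) atTop id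
      (fun _ => P) (multivariateGaussian 0 S) := by
  have hm : ∀ i, AEMeasurable (X i) P := fun i => (hident i).aemeasurable_fst
  refine ⟨fun n => by fun_prop,
    aemeasurable_id, ?_⟩
  refine ProbabilityMeasure.tendsto_iff_tendsto_charFun.2 fun t => ?_
  -- Cramér–Wold: the characteristic function of the vector sum at `t` is that of its projection
  -- along `t` at `1`, so the real central limit theorem applies for each `t`.
  have key := tendstoInDistribution_inv_sqrt_mul_sum_sub
    (P := P) (X := fun i ω => inner ℝ (X i ω) t) (Y := id)
    (P' := gaussianReal 0 (Var[fun ω => inner ℝ (X 0 ω) t; P]).toNNReal)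
    ⟨aemeasurable_id, Measure.map_id⟩ (hL2 t)
    (hindep.comp (fun _ x => inner ℝ x t) (fun _ => by fun_prop))
    (fun i => (hident i).comp (u := fun x => inner ℝ x t) (by fun_prop))
  have hlim := ProbabilityMeasure.tendsto_iff_tendsto_charFun.1 key.tendsto 1
  simp only [hmean, mul_zero, sub_zero, ProbabilityMeasure.coe_mk, Measure.map_id,
    charFun_gaussianReal, hvar] at hlim
  simp only [ProbabilityMeasure.coe_mk, Measure.map_id, charFun_multivariateGaussian hS]
  have hnn : 0 ≤ t ⬝ᵥ S.mulVec t := by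
    rw [← hvar]
    exact variance_nonneg _ _
  convert! hlim using 2
  · rename_i n
    have hmn : AEMeasurable (fun ω => (√n)⁻¹ • ∑ k ∈ Finset.range n, X k ω) P := by
      fun_prop
    rw [charFun_apply, charFun_apply_real, integral_map hmn (by fun_prop),
      integral_map (by fun_prop) (by fun_prop)]
    simp only [real_inner_smul_left, sum_inner]
    simp
  · simp [Real.coe_toNNReal _ hnn]

/-! ### Laws of large numbers for the sample quantities -/

theorem continuous_matrix_det_of {p : ℕ} :
    Continuous fun A : Fin p → Fin p → ℝ => (Matrix.of A).det :=
  Continuous.matrix_det (continuous_id (X := Matrix (Fin p) (Fin p) ℝ))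

theorem continuous_matrix_adjugate_of {p : ℕ} (j k : Fin p) :
    Continuous fun A : Fin p → Fin p → ℝ => (Matrix.of A).adjugate j k :=
  (Continuous.matrix_adjugate (continuous_id (X := Matrix (Fin p) (Fin p) ℝ))).matrix_elem j k

/-- This form gives both the measurability of the inverse on all matrices, with value `0` at
singular ones, and its continuity at invertible ones. -/
theorem matrix_inv_apply {p : ℕ} (A : Matrix (Fin p) (Fin p) ℝ) (j k : Fin p) :
    A⁻¹ j k = A.det⁻¹ * A.adjugate j k := by
  rw [Matrix.inv_def, Matrix.smul_apply, Ring.inverse_eq_inv', smul_eq_mul]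

theorem measurable_matrix_inv_of {p : ℕ} (j k : Fin p) :
    Measurable fun A : Fin p → Fin p → ℝ => (Matrix.of A)⁻¹ j k := by
  simp only [matrix_inv_apply]
  exact continuous_matrix_det_of.measurable.inv.mul (continuous_matrix_adjugate_of j k).measurable

theorem tendsto_matrix_inv_of {p : ℕ} {A : ℕ → Fin p → Fin p → ℝ} {B : Fin p → Fin p → ℝ}
    (hA : Tendsto A atTop (𝓝 B)) (hB : IsUnit (Matrix.of B)) (j k : Fin p) :
    Tendsto (fun n => (Matrix.of (A n))⁻¹ j k) atTop (𝓝 ((Matrix.of B)⁻¹ j k)) := by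
  simp only [matrix_inv_apply]
  have hdet : (Matrix.of B).det ≠ 0 := ((Matrix.isUnit_iff_isUnit_det _).1 hB).ne_zero
  exact (((continuous_matrix_det_of.tendsto B).comp hA).inv₀ hdet).mul
    (((continuous_matrix_adjugate_of j k).tendsto B).comp hA)

theorem eventually_isUnit_of_tendsto {p : ℕ} {A : ℕ → Fin p → Fin p → ℝ} {B : Fin p → Fin p → ℝ}
    (hA : Tendsto A atTop (𝓝 B)) (hB : IsUnit (Matrix.of B)) :
    ∀ᶠ n in atTop, IsUnit (Matrix.of (A n)) := by
  have hdet : (Matrix.of B).det ≠ 0 := ((Matrix.isUnit_iff_isUnit_det _).1 hB).ne_zero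
  filter_upwards [((continuous_matrix_det_of.tendsto B).comp hA).eventually_ne hdet] with n hn
  exact (Matrix.isUnit_iff_isUnit_det _).2 (isUnit_iff_ne_zero.2 hn)

section LLN

variable {Ω Ω' E : Type*} [MeasurableSpace Ω] [MeasurableSpace Ω'] [MeasurableSpace E]
  {P : Measure Ω} {Q : Measure Ω'}
  {U : ℕ → Ω' → E} {W : Ω → E}

theorem tendsto_empirical_mean_ae (hindep : iIndepFun U Q)
    (hident : ∀ i, IdentDistrib (U i) W Q P) {f : E → ℝ} (hf : Measurable f)
    (hint : Integrable (fun ω => f (W ω)) P) :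
    ∀ᵐ ω ∂Q, Tendsto (fun n : ℕ => (n : ℝ)⁻¹ * ∑ i : Fin n, f (U i ω)) atTop
      (𝓝 (∫ ω, f (W ω) ∂P)) := by
  have hid : ∀ i, IdentDistrib (fun ω => f (U i ω)) (fun ω => f (W ω)) Q P :=
    fun i => (hident i).comp hf
  have h := strong_law_ae_real (μ := Q) (fun i ω => f (U i ω)) ((hid 0).integrable_iff.2 hint)
    (fun i j hij => (hindep.indepFun hij).comp hf hf)
    (fun i => (hid i).trans (hid 0).symm)
  filter_upwards [h] with ω hω
  rw [← (hid 0).integral_eq]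
  refine hω.congr fun n => ?_
  rw [Finset.sum_range, div_eq_inv_mul]

theorem tendsto_empCov_ae [IsProbabilityMeasure P] (hindep : iIndepFun U Q)
    (hident : ∀ i, IdentDistrib (U i) W Q P) {f g : E → ℝ} (hf : Measurable f) (hg : Measurable g)
    (hf2 : MemLp (fun ω => f (W ω)) 2 P) (hg2 : MemLp (fun ω => g (W ω)) 2 P) :
    ∀ᵐ ω ∂Q, Tendsto (fun n : ℕ => empCov (fun i : Fin n => f (U i ω)) (fun i => g (U i ω))) atTop
      (𝓝 (cov[fun ω => f (W ω), fun ω => g (W ω); P])) := by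
  filter_upwards [tendsto_empirical_mean_ae hindep hident hf (hf2.integrable (by norm_num)),
    tendsto_empirical_mean_ae hindep hident hg (hg2.integrable (by norm_num)),
    tendsto_empirical_mean_ae hindep hident (hf.mul hg) (hf2.integrable_mul hg2)] with ω h₁ h₂ h₃
  rw [covariance_eq_sub hf2 hg2]
  exact h₃.sub (h₁.mul h₂)

/-- Centering turns the second moment into a variance, which is additive under pairwise
independence. At `n = 0` both sides are zero. -/
theorem integral_sq_empirical_mean [IsProbabilityMeasure Q] (hindep : iIndepFun U Q)
    (hident : ∀ i, IdentDistrib (U i) W Q P) {f : E → ℝ} (hf : Measurable f)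
    (hf2 : MemLp (fun ω => f (W ω)) 2 P) (hf0 : ∫ ω, f (W ω) ∂P = 0) (n : ℕ) :
    Integrable (fun ω => ((n : ℝ)⁻¹ * ∑ i : Fin n, f (U i ω)) ^ 2) Q ∧
    ∫ ω, ((n : ℝ)⁻¹ * ∑ i : Fin n, f (U i ω)) ^ 2 ∂Q =
      (n : ℝ)⁻¹ * Var[fun ω => f (W ω); P] := by
  have hid : ∀ i, IdentDistrib (fun ω => f (U i ω)) (fun ω => f (W ω)) Q P :=
    fun i => (hident i).comp hf
  have hL : ∀ i, MemLp (fun ω => f (U i ω)) 2 Q := fun i => (hid i).memLp_iff.2 hf2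
  have hS : MemLp (fun ω => ∑ i : Fin n, f (U i ω)) 2 Q := memLp_finsetSum _ fun i _ => hL i
  have hM : MemLp (fun ω => (n : ℝ)⁻¹ * ∑ i : Fin n, f (U i ω)) 2 Q := hS.const_mul _
  refine ⟨hM.integrable_sq, ?_⟩
  have h0 : ∫ ω, (n : ℝ)⁻¹ * ∑ i : Fin n, f (U i ω) ∂Q = 0 := by
    rw [integral_const_mul, integral_finsetSum (f := fun (i : Fin n) ω => f (U i ω)) _
      fun i _ => (hL i).integrable (by norm_num)]
    simp [fun i => (hid i).integral_eq, hf0]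
  rw [← variance_of_integral_eq_zero hM.aemeasurable h0, variance_const_mul]
  have hv := IndepFun.variance_sum (μ := Q) (X := fun i ω => f (U i ω)) (s := Finset.range n)
    (fun i _ => hL i) (fun i _ j _ hij => (hindep.indepFun hij).comp hf hf)
  have e : (∑ i ∈ Finset.range n, fun ω => f (U i ω)) = fun ω => ∑ i : Fin n, f (U i ω) := by
    ext ω
    rw [Finset.sum_apply, Finset.sum_range]
  rw [e] at hv
  rw [hv]
  simp only [fun i => (hid i).variance_eq, Finset.sum_const, Finset.card_range, nsmul_eq_mul]
  rcases Nat.eq_zero_or_pos n with rfl | hn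
  · simp
  field_simp

/-- The product of two empirical means of centered variables is negligible at the scale
`n ^ (-1 / 2)`. -/
theorem tendstoInMeasure_sqrt_mul_empirical_means [IsProbabilityMeasure Q] {p : ℕ}
    (hindep : iIndepFun U Q)
    (hident : ∀ i, IdentDistrib (U i) W Q P) {f : E → ℝ} {g : Fin p → E → ℝ} (hf : Measurable f)
    (hg : ∀ j, Measurable (g j)) (hf2 : MemLp (fun ω => f (W ω)) 2 P)
    (hg2 : ∀ j, MemLp (fun ω => g j (W ω)) 2 P) (hf0 : ∫ ω, f (W ω) ∂P = 0)
    (hg0 : ∀ j, ∫ ω, g j (W ω) ∂P = 0) :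
    TendstoInMeasure Q (fun (n : ℕ) ω j => √n * (((n : ℝ)⁻¹ * ∑ i : Fin n, f (U i ω)) *
      ((n : ℝ)⁻¹ * ∑ i : Fin n, g j (U i ω)))) atTop fun _ => (0 : Fin p → ℝ) := by
  have hU : ∀ i, AEMeasurable (U i) Q := fun i => (hident i).aemeasurable_fst
  have hfU : ∀ i, AEMeasurable (fun ω => f (U i ω)) Q := fun i => hf.comp_aemeasurable (hU i)
  have hgU : ∀ j i, AEMeasurable (fun ω => g j (U i ω)) Q :=
    fun j i => (hg j).comp_aemeasurable (hU i)
  have hmf : ∀ n : ℕ, AEMeasurable (fun ω => (n : ℝ)⁻¹ * ∑ i : Fin n, f (U i ω)) Q :=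
    fun n => by fun_prop
  have hmg : ∀ (n : ℕ) j, AEMeasurable (fun ω => (n : ℝ)⁻¹ * ∑ i : Fin n, g j (U i ω)) Q :=
    fun n j => by fun_prop
  refine tendstoInMeasure_of_tendsto_eLpNorm (p := 1) one_ne_zero (fun n => ?_) (by fun_prop) ?_
  · exact (aemeasurable_pi_lambda _ fun j =>
      ((hmf n).mul (hmg n j)).const_mul _).aestronglyMeasurable
  set C : ℝ := ∑ j, (Var[fun ω => f (W ω); P] + Var[fun ω => g j (W ω); P]) with hC
  have hC0 : 0 ≤ C := Finset.sum_nonneg fun j _ => add_nonneg (variance_nonneg _ _)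
    (variance_nonneg _ _)
  have hbound : ∀ n : ℕ, eLpNorm ((fun ω j => √n * (((n : ℝ)⁻¹ * ∑ i : Fin n, f (U i ω)) *
      ((n : ℝ)⁻¹ * ∑ i : Fin n, g j (U i ω)))) - fun _ => (0 : Fin p → ℝ)) 1 Q ≤
      ENNReal.ofReal ((√n)⁻¹ * C) := by
    intro n
    have hf' := integral_sq_empirical_mean hindep hident hf hf2 hf0 n
    have hg' := fun j => integral_sq_empirical_mean hindep hident (hg j) (hg2 j) (hg0 j) n
    set F : Ω' → ℝ := fun ω => (n : ℝ)⁻¹ * ∑ i : Fin n, f (U i ω) with hF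
    set G : Fin p → Ω' → ℝ := fun j ω => (n : ℝ)⁻¹ * ∑ i : Fin n, g j (U i ω) with hG
    -- `|F G| ≤ F² + G²`, and the sum over `j` dominates the supremum norm. Each mean square is of
    -- order `1 / n`, so `D` has expectation `√n · n⁻¹ · C = C / √n`.
    set D : Ω' → ℝ := fun ω => ∑ j, √n * (F ω ^ 2 + G j ω ^ 2) with hD
    have hterm : ∀ j, Integrable (fun ω => √n * (F ω ^ 2 + G j ω ^ 2)) Q :=
      fun j => (hf'.1.add (hg' j).1).const_mul _
    have hDint : Integrable D Q := integrable_finsetSum _ fun j _ => hterm j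
    have hD0 : ∀ ω, 0 ≤ D ω := fun ω => Finset.sum_nonneg fun j _ => by positivity
    have hDval : ∫ ω, D ω ∂Q = (√n)⁻¹ * C := by
      rw [hD, integral_finsetSum _ fun j _ => hterm j, hC, Finset.mul_sum]
      refine Finset.sum_congr rfl fun j _ => ?_
      rw [integral_const_mul, integral_add hf'.1 (hg' j).1, hf'.2, (hg' j).2, ← mul_add,
        ← mul_assoc]
      congr 1
      rw [← div_eq_mul_inv, Real.sqrt_div_self]
    calc _ ≤ eLpNorm D 1 Q := by
          refine eLpNorm_mono_real fun ω => ?_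
          simp only [Pi.sub_apply, sub_zero]
          refine (pi_norm_le_iff_of_nonneg (hD0 ω)).2 fun j => ?_
          have h1 : ‖√n * (F ω * G j ω)‖ ≤ √n * (F ω ^ 2 + G j ω ^ 2) := by
            rw [norm_mul, Real.norm_of_nonneg (Real.sqrt_nonneg _)]
            refine mul_le_mul_of_nonneg_left ?_ (Real.sqrt_nonneg _)
            rw [Real.norm_eq_abs, abs_le]
            constructor <;> nlinarith [sq_nonneg (F ω + G j ω), sq_nonneg (F ω - G j ω),
              sq_nonneg (F ω), sq_nonneg (G j ω)]
          exact h1.trans (Finset.single_le_sum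
            (f := fun j => √n * (F ω ^ 2 + G j ω ^ 2)) (fun j _ => by positivity)
            (Finset.mem_univ j))
      _ = ENNReal.ofReal ((√n)⁻¹ * C) := by
          rw [eLpNorm_one_eq_lintegral_enorm, ← ofReal_integral_norm_eq_lintegral_enorm hDint,
            ← hDval]
          simp only [Real.norm_of_nonneg (hD0 _)]
  refine tendsto_of_tendsto_of_tendsto_of_le_of_le tendsto_const_nhds ?_ (fun n => zero_le)
    hbound
  have h : Tendsto (fun n : ℕ => (√n)⁻¹ * C) atTop (𝓝 (0 * C)) :=
    (tendsto_inv_atTop_zero.comp (Real.tendsto_sqrt_atTop.comp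
      tendsto_natCast_atTop_atTop)).mul_const C
  simpa using ENNReal.tendsto_ofReal h

end LLN

/-! ### Asymptotics of the empirical multiple correlation coefficient -/

section Sample

variable {Ω Ω' : Type*} [MeasurableSpace Ω] [MeasurableSpace Ω']
  {P : Measure Ω} [IsProbabilityMeasure P] {Q : Measure Ω'} [IsProbabilityMeasure Q] {p : ℕ}
  {Y : Ω → ℝ} {X : Fin p → Ω → ℝ}
  {Ys : ℕ → Ω' → ℝ} {Xs : ℕ → Fin p → Ω' → ℝ}

omit [IsProbabilityMeasure P] [IsProbabilityMeasure Q] in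
theorem aemeasurable_sampleR2 (hident : ∀ i, IdentDistrib (fun ω => (Ys i ω, fun j => Xs i j ω))
      (fun ω => (Y ω, fun j => X j ω)) Q P) (n : ℕ) :
    AEMeasurable (sampleR2 Ys Xs n) Q := by
  have h : Measurable fun u : Fin n → ℝ × (Fin p → ℝ) =>
      empR2 (WithLp.toLp 2 fun i => (u i).1) (fun j => WithLp.toLp 2 fun i => (u i).2 j) :=
    measurable_empR2 (y := fun u : Fin n → ℝ × (Fin p → ℝ) => WithLp.toLp 2 fun i => (u i).1)
      (x := fun j u => WithLp.toLp 2 fun i => (u i).2 j) (by fun_prop) (fun j => by fun_prop)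
  have hU : AEMeasurable (fun ω (i : Fin n) => (Ys i ω, fun j => Xs i j ω)) Q :=
    aemeasurable_pi_lambda _ fun i => (hident i).aemeasurable_fst
  have hc := h.comp_aemeasurable hU
  exact hc

omit [IsProbabilityMeasure Q] in
theorem tendsto_empVar_sampleVec_ae (hY : MemLp Y 2 P)
    (hindep : iIndepFun (fun i ω => (Ys i ω, fun j => Xs i j ω)) Q)
    (hident : ∀ i, IdentDistrib (fun ω => (Ys i ω, fun j => Xs i j ω))
      (fun ω => (Y ω, fun j => X j ω)) Q P) :
    ∀ᵐ ω ∂Q, Tendsto (fun n => empVar (sampleVec Ys n ω)) atTop (𝓝 Var[Y; P]) := by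
  have h := tendsto_empCov_ae hindep hident (f := Prod.fst) (g := Prod.fst) measurable_fst
    measurable_fst hY hY
  rw [covariance_self hY.aemeasurable] at h
  filter_upwards [h] with ω hω
  exact hω.congr fun n => (empVar_eq_empCov _).symm

omit [IsProbabilityMeasure Q] in
theorem tendsto_empCov_sampleVec_ae (hX : ∀ j, MemLp (X j) 2 P)
    (hindep : iIndepFun (fun i ω => (Ys i ω, fun j => Xs i j ω)) Q)
    (hident : ∀ i, IdentDistrib (fun ω => (Ys i ω, fun j => Xs i j ω))
      (fun ω => (Y ω, fun j => X j ω)) Q P) :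
    ∀ᵐ ω ∂Q, Tendsto (fun (n : ℕ) j k => empCov (sampleVec (fun i => Xs i j) n ω).ofLp
      (sampleVec (fun i => Xs i k) n ω).ofLp) atTop (𝓝 fun j k => cov[X j, X k; P]) := by
  have h : ∀ j k, ∀ᵐ ω ∂Q, Tendsto (fun (n : ℕ) =>
      empCov (sampleVec (fun i => Xs i j) n ω).ofLp (sampleVec (fun i => Xs i k) n ω).ofLp) atTop
        (𝓝 cov[X j, X k; P]) := fun j k =>
    tendsto_empCov_ae hindep hident (f := fun w => w.2 j) (g := fun w => w.2 k)
      (by fun_prop) (by fun_prop) (hX j) (hX k)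
  filter_upwards [ae_all_iff.2 fun j => ae_all_iff.2 (h j)] with ω hω
  exact tendsto_pi_nhds.2 fun j => tendsto_pi_nhds.2 fun k => hω j k

omit [IsProbabilityMeasure Q] in
theorem sampleR2_eq_one_ae (hY : MemLp Y 2 P) (hX : ∀ j, MemLp (X j) 2 P) (hVar : 0 < Var[Y; P])
    (hident : ∀ i, IdentDistrib (fun ω => (Ys i ω, fun j => Xs i j ω))
      (fun ω => (Y ω, fun j => X j ω)) Q P) (hR : popR2 hY hX = 1) :
    ∀ᵐ ω ∂Q, ∀ n, 0 < empVar (sampleVec Ys n ω) → sampleR2 Ys Xs n ω = 1 := by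
  set a := popAlpha hY hX with ha
  set b := P[Y] - ∑ j, a j * P[X j] with hb
  have hP : ∀ᵐ ω ∂P, Y ω = b + ∑ j, a j * X j ω := by
    filter_upwards [explained_ae_of_popR2_eq_one hY hX hVar hR] with ω hω
    simp only [explained, mul_sub, Finset.sum_sub_distrib, ← ha] at hω
    rw [hb]
    linarith
  -- The affine relation defines a measurable set of observations, so its almost sure validity
  -- depends only on the common law.
  have hQ : ∀ᵐ ω ∂Q, ∀ i, Ys i ω = b + ∑ j, a j * Xs i j ω :=
    ae_all_iff.2 fun i => (hident i).symm.ae_snd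
      (p := fun w : ℝ × (Fin p → ℝ) => w.1 = b + ∑ j, a j * w.2 j)
      (measurableSet_eq_fun (by fun_prop) (by fun_prop)) hP
  filter_upwards [hQ] with ω hω n hn
  exact empR2_eq_one_of_mem b a (fun i => hω i) hn

/-! ### Linearization and central limit theorem when `R² = 0` -/

variable (P Y X) in
/-- The summand `B (X_c Y_c, X_c Y_c)` of the linearization of the regression coefficients, as a
function of the observation. -/
noncomputable def influence (w : ℝ × (Fin p → ℝ)) : EuclideanSpace ℝ (Fin p ⊕ Fin p) :=
  WithLp.toLp 2 ((matB P Y X).mulVec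
    (Sum.elim (fun j => (w.2 j - P[X j]) * (w.1 - P[Y])) fun j => (w.2 j - P[X j]) * (w.1 - P[Y])))

omit [IsProbabilityMeasure P] in
theorem measurable_influence : Measurable (influence P Y X) := by
  have h : Measurable fun w : ℝ × (Fin p → ℝ) => (Sum.elim
      (fun j => (w.2 j - P[X j]) * (w.1 - P[Y])) fun j => (w.2 j - P[X j]) * (w.1 - P[Y]) :
        Fin p ⊕ Fin p → ℝ) := by
    refine measurable_pi_lambda _ fun i => ?_
    rcases i with j | j <;> simp only [Sum.elim_inl, Sum.elim_inr] <;> fun_prop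
  have h' : Measurable fun w : ℝ × (Fin p → ℝ) => (matB P Y X).mulVec (Sum.elim
      (fun j => (w.2 j - P[X j]) * (w.1 - P[Y])) fun j => (w.2 j - P[X j]) * (w.1 - P[Y])) := by
    unfold Matrix.mulVec dotProduct
    fun_prop
  unfold influence
  fun_prop

omit [IsProbabilityMeasure P] in
theorem influence_inr (w : ℝ × (Fin p → ℝ)) (j : Fin p) :
    influence P Y X w (Sum.inr j) = Var[Y; P]⁻¹ * ((w.2 j - P[X j]) * (w.1 - P[Y])) := by
  simp [influence, matB, Matrix.fromBlocks_mulVec, Matrix.smul_mulVec]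

omit [IsProbabilityMeasure P] in
theorem influence_inl (w : ℝ × (Fin p → ℝ)) (j : Fin p) :
    influence P Y X w (Sum.inl j) =
      ∑ k, (covX P X)⁻¹ j k * ((w.2 k - P[X k]) * (w.1 - P[Y])) := by
  simp [influence, matB, Matrix.fromBlocks_mulVec, Matrix.mulVec, dotProduct]

omit [IsProbabilityMeasure P] in
theorem inner_influence (w : ℝ × (Fin p → ℝ)) (t : EuclideanSpace ℝ (Fin p ⊕ Fin p)) :
    inner ℝ (influence P Y X w) t = ∑ i, (matB P Y X).mulVec t i *
      (Sum.elim (fun j => (w.2 j - P[X j]) * (w.1 - P[Y]))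
        (fun j => (w.2 j - P[X j]) * (w.1 - P[Y])) : Fin p ⊕ Fin p → ℝ) i := by
  set s : Fin p ⊕ Fin p → ℝ := Sum.elim (fun j => (w.2 j - P[X j]) * (w.1 - P[Y]))
    (fun j => (w.2 j - P[X j]) * (w.1 - P[Y])) with hs
  have h : inner ℝ (influence P Y X w) t = t.ofLp ⬝ᵥ (matB P Y X).mulVec s := by
    rw [PiLp.inner_apply]
    simp [influence, dotProduct, hs]
  rw [h, Matrix.dotProduct_mulVec, ← Matrix.mulVec_transpose, matB_isSymm]
  rfl

/-- The explained part and `θ` vanish, so the residuals reduce to the centered variables and both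
halves of the score coincide. -/
theorem score_ae_of_popR2_eq_zero (hY : MemLp Y 2 P) (hX : ∀ j, MemLp (X j) 2 P)
    (hVar : 0 < Var[Y; P]) (hR : popR2 hY hX = 0) :
    (∀ j, cov[X j, Y; P] = 0) ∧ ∀ᵐ ω ∂P, ∀ i, score hY hX i ω =
      (Sum.elim (fun j => (X j ω - P[X j]) * (Y ω - P[Y]))
        (fun j => (X j ω - P[X j]) * (Y ω - P[Y])) : Fin p ⊕ Fin p → ℝ) i := by
  have hT := explained_ae_of_popR2_eq_zero hY hX hVar hR
  have hcov : ∀ j, cov[X j, Y; P] = 0 := by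
    intro j
    rw [covariance_comm, ← sum_popAlpha_mul_cov hY hX j, ← covariance_explained hY hX (hX j),
      covariance, integral_congr_ae hT]
    refine (integral_congr_ae ?_).trans (integral_zero _ _)
    filter_upwards [hT] with ω hω
    simp [hω]
  refine ⟨hcov, ?_⟩
  have hθ : popTheta P Y X = 0 := by
    ext k
    rw [popTheta, covariance_comm, hcov, zero_div, Pi.zero_apply]
  filter_upwards [hT, resY_ae hY hX, ae_all_iff.2 (resX_ae hY hX hVar)] with ω h₁ h₂ h₃ i
  rcases i with j | j
  · simp [score, h₂, h₁]
  · simp [score, h₃, hθ, mul_comm]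

theorem tendstoInDistribution_sum_influence (hY : MemLp Y 2 P) (hX : ∀ j, MemLp (X j) 2 P)
    (hVar : 0 < Var[Y; P])
    (hindep : iIndepFun (fun i ω => (Ys i ω, fun j => Xs i j ω)) Q)
    (hident : ∀ i, IdentDistrib (fun ω => (Ys i ω, fun j => Xs i j ω))
      (fun ω => (Y ω, fun j => X j ω)) Q P)
    (hmom₁ : ∀ j, Integrable (fun ω => (X j ω - P[X j]) ^ 2 * resY hY hX ω ^ 2) P)
    (hmom₂ : ∀ j, Integrable (fun ω => (Y ω - P[Y]) ^ 2 * resX hY hX j ω ^ 2) P)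
    (hR : popR2 hY hX = 0) :
    TendstoInDistribution (fun (n : ℕ) ω => (√n)⁻¹ • ∑ k ∈ Finset.range n,
      influence P Y X (Ys k ω, fun j => Xs k j ω)) atTop id
      (fun _ => Q) (multivariateGaussian 0 (matBAB hY hX)) := by
  obtain ⟨hcov, hsc⟩ := score_ae_of_popR2_eq_zero hY hX hVar hR
  have hs := memLp_score hY hX hmom₁ hmom₂
  have hid : ∀ i, IdentDistrib (fun ω => influence P Y X (Ys i ω, fun j => Xs i j ω))
      (fun ω => influence P Y X (Y ω, fun j => X j ω)) Q P :=
    fun i => (hident i).comp measurable_influence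
  have hidt : ∀ t, IdentDistrib (fun ω => inner ℝ (influence P Y X (Ys 0 ω, fun j => Xs 0 j ω)) t)
      (fun ω => inner ℝ (influence P Y X (Y ω, fun j => X j ω)) t) Q P :=
    fun t => (hid 0).comp (u := fun x => inner ℝ x t) (by fun_prop)
  have hae : ∀ t : EuclideanSpace ℝ (Fin p ⊕ Fin p),
      (fun ω => inner ℝ (influence P Y X (Y ω, fun j => X j ω)) t) =ᵐ[P]
        fun ω => ∑ i, (matB P Y X).mulVec t i * score hY hX i ω := by
    intro t
    filter_upwards [hsc] with ω hω
    simp only [inner_influence, hω]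
  have hL : ∀ t : EuclideanSpace ℝ (Fin p ⊕ Fin p),
      MemLp (fun ω => inner ℝ (influence P Y X (Y ω, fun j => X j ω)) t) 2 P := fun t =>
    (memLp_congr_ae (hae t)).2 (memLp_finsetSum _ fun i _ => (hs i).const_mul _)
  have hs0 : ∀ i, ∫ ω, score hY hX i ω ∂P = 0 := by
    intro i
    have hsi : score hY hX i =ᵐ[P] fun ω => (Sum.elim (fun j => (X j ω - P[X j]) * (Y ω - P[Y]))
        (fun j => (X j ω - P[X j]) * (Y ω - P[Y])) : Fin p ⊕ Fin p → ℝ) i :=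
      hsc.mono fun ω hω => hω i
    rw [integral_congr_ae hsi]
    -- The mean of `(X j - E X j)(Y - E Y)` is by definition a covariance, here zero.
    rcases i with j | j <;> exact hcov j
  have h0 : ∀ t, ∫ ω, inner ℝ (influence P Y X (Y ω, fun j => X j ω)) t ∂P = 0 := by
    intro t
    rw [integral_congr_ae (hae t),
      integral_finsetSum _ fun i _ => ((hs i).const_mul _).integrable (by norm_num)]
    simp [integral_const_mul, hs0]
  refine tendstoInDistribution_inv_sqrt_smul_sum_multivariate
    (posSemidef_matBAB hY hX hmom₁ hmom₂)
    (hindep.comp (fun _ => influence P Y X) fun _ => measurable_influence)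
    (fun i => (hid i).trans (hid 0).symm) (fun t => (hidt t).memLp_iff.2 (hL t))
    (fun t => (hidt t).integral_eq.trans (h0 t)) fun t => ?_
  rw [(hidt t).variance_eq, variance_of_integral_eq_zero (hL t).aemeasurable (h0 t),
    dotProduct_matBAB_mulVec hY hX hmom₁ hmom₂]
  refine integral_congr_ae ?_
  filter_upwards [hae t] with ω hω
  rw [hω]

/-! ### Slutsky's argument for `n R̂²` -/

/-- The matrix `M_n⁻¹ / Var_n(Y)`. -/
noncomputable def empPrecision (Ys : ℕ → Ω' → ℝ) (Xs : ℕ → Fin p → Ω' → ℝ) (n : ℕ) (ω : Ω')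
    (j k : Fin p) : ℝ :=
  (Matrix.of fun j k => empCov (sampleVec (fun i => Xs i j) n ω).ofLp
    (sampleVec (fun i => Xs i k) n ω).ofLp)⁻¹ j k / empVar (sampleVec Ys n ω)

omit [IsProbabilityMeasure Q] in
theorem aemeasurable_empPrecision (hY : ∀ i, AEMeasurable (Ys i) Q)
    (hX : ∀ i j, AEMeasurable (Xs i j) Q) (n : ℕ) : AEMeasurable (empPrecision Ys Xs n) Q := by
  have hV : AEMeasurable (fun ω => empVar (sampleVec Ys n ω)) Q :=
    measurable_empVar.comp_aemeasurable (by unfold sampleVec; fun_prop)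
  have hC : AEMeasurable (fun ω j k => empCov (sampleVec (fun i => Xs i j) n ω).ofLp
    (sampleVec (fun i => Xs i k) n ω).ofLp) Q := by
    unfold empCov sampleVec
    fun_prop
  refine aemeasurable_pi_lambda _ fun j => aemeasurable_pi_lambda _ fun k => ?_
  exact ((measurable_matrix_inv_of j k).comp_aemeasurable hC).div hV

omit [IsProbabilityMeasure Q] in
theorem tendsto_empPrecision_ae (hY : MemLp Y 2 P) (hX : ∀ j, MemLp (X j) 2 P)
    (hVar : 0 < Var[Y; P]) (hM : IsUnit (covX P X))
    (hindep : iIndepFun (fun i ω => (Ys i ω, fun j => Xs i j ω)) Q)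
    (hident : ∀ i, IdentDistrib (fun ω => (Ys i ω, fun j => Xs i j ω))
      (fun ω => (Y ω, fun j => X j ω)) Q P) :
    ∀ᵐ ω ∂Q, Tendsto (fun n => empPrecision Ys Xs n ω) atTop
      (𝓝 fun j k => (covX P X)⁻¹ j k / Var[Y; P]) := by
  filter_upwards [tendsto_empVar_sampleVec_ae hY hindep hident,
    tendsto_empCov_sampleVec_ae hX hindep hident] with ω h₁ h₂
  exact tendsto_pi_nhds.2 fun j => tendsto_pi_nhds.2 fun k =>
    (tendsto_matrix_inv_of h₂ hM j k).div h₁ hVar.ne'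

/-- The map through which `n R̂²` is a function of the normalized sum of the influences, of the
empirical precision matrix and of a negligible remainder. -/
def statMap (v : ℝ) (M : Matrix (Fin p) (Fin p) ℝ)
    (s : (EuclideanSpace ℝ (Fin p ⊕ Fin p) × (Fin p → Fin p → ℝ)) × (Fin p → ℝ)) : ℝ :=
  ∑ j, s.1.1 (Sum.inl j) * s.1.1 (Sum.inr j) +
    ∑ j, ∑ k, (v * s.1.1 (Sum.inr j) - s.2 j) *
      (s.1.2 j k * (v * s.1.1 (Sum.inr k) - s.2 k)) -
    ∑ j, ∑ k, v * s.1.1 (Sum.inr j) * (M j k * s.1.1 (Sum.inr k))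

theorem continuous_statMap (v : ℝ) (M : Matrix (Fin p) (Fin p) ℝ) : Continuous (statMap v M) := by
  unfold statMap
  fun_prop

/-- The first sum of `statMap` is the announced limit; the second is the statistic. At the limit the
second and third cancel, whereas at finite `n` the first and third do. No linear relation between
the two halves of the Gaussian vector has to be established. -/
theorem statMap_limit {v : ℝ} (hv : v ≠ 0) (M : Matrix (Fin p) (Fin p) ℝ)
    (G : EuclideanSpace ℝ (Fin p ⊕ Fin p)) :
    statMap v M ((G, fun j k => M j k / v), 0) = ∑ j, G (Sum.inl j) * G (Sum.inr j) := by
  unfold statMap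
  have h : ∀ j k, (v * G (Sum.inr j) - (0 : Fin p → ℝ) j) *
      (M j k / v * (v * G (Sum.inr k) - (0 : Fin p → ℝ) k)) =
      v * G (Sum.inr j) * (M j k * G (Sum.inr k)) := fun j k => by
    simp only [Pi.zero_apply, sub_zero]
    field_simp
  simp only [h]
  ring

/-- The remainder `√n (X̄ j - E X j) (Ȳ - E Y)`. -/
noncomputable def meanRemainder (P : Measure Ω) (Y : Ω → ℝ) (X : Fin p → Ω → ℝ)
    (Ys : ℕ → Ω' → ℝ) (Xs : ℕ → Fin p → Ω' → ℝ) (n : ℕ) (ω : Ω') (j : Fin p) : ℝ :=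
  √n * (((n : ℝ)⁻¹ * ∑ i : Fin n, (Ys i ω - P[Y])) *
      ((n : ℝ)⁻¹ * ∑ i : Fin n, (Xs i j ω - P[X j])))

theorem tendstoInMeasure_meanRemainder (hY : MemLp Y 2 P) (hX : ∀ j, MemLp (X j) 2 P)
    (hindep : iIndepFun (fun i ω => (Ys i ω, fun j => Xs i j ω)) Q)
    (hident : ∀ i, IdentDistrib (fun ω => (Ys i ω, fun j => Xs i j ω))
      (fun ω => (Y ω, fun j => X j ω)) Q P) :
    TendstoInMeasure Q (meanRemainder P Y X Ys Xs) atTop fun _ => 0 := by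
  have hY0 : ∫ ω, (Y ω - P[Y]) ∂P = 0 := by
    simp [integral_sub (hY.integrable (by norm_num)) (integrable_const _)]
  have hX0 : ∀ j, ∫ ω, (X j ω - P[X j]) ∂P = 0 := fun j => by
    simp [integral_sub ((hX j).integrable (by norm_num)) (integrable_const _)]
  have hY2 : MemLp (fun ω => Y ω - P[Y]) 2 P := hY.sub (memLp_const _)
  have hX2 : ∀ j, MemLp (fun ω => X j ω - P[X j]) 2 P := fun j => (hX j).sub (memLp_const _)
  have hf : Measurable fun w : ℝ × (Fin p → ℝ) => w.1 - P[Y] := by fun_prop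
  have hg : ∀ j, Measurable fun w : ℝ × (Fin p → ℝ) => w.2 j - P[X j] := fun j => by fun_prop
  have h := tendstoInMeasure_sqrt_mul_empirical_means hindep hident hf hg hY2 hX2 hY0 hX0
  exact h

omit [MeasurableSpace Ω'] [IsProbabilityMeasure P] in
/-- The exact expression of `n R̂²` when the empirical covariance matrix is invertible. -/
theorem natCast_mul_sampleR2_eq_statMap (hVar : 0 < Var[Y; P]) {n : ℕ} (hn : 0 < n) {ω : Ω'}
    (hM : IsUnit (Matrix.of fun j k => empCov (sampleVec (fun i => Xs i j) n ω).ofLp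
      (sampleVec (fun i => Xs i k) n ω).ofLp)) :
    (n : ℝ) * sampleR2 Ys Xs n ω = statMap Var[Y; P] (covX P X)⁻¹
      (((√n)⁻¹ • ∑ k ∈ Finset.range n, influence P Y X (Ys k ω, fun j => Xs k j ω),
        empPrecision Ys Xs n ω), meanRemainder P Y X Ys Xs n ω) := by
  have hn' : (0 : ℝ) < n := by exact_mod_cast hn
  set S := (√n)⁻¹ • ∑ k ∈ Finset.range n, influence P Y X (Ys k ω, fun j => Xs k j ω) with hS
  set z : Fin p → ℝ := fun j =>
    (√n)⁻¹ * ∑ i : Fin n, (Xs i j ω - P[X j]) * (Ys i ω - P[Y]) with hz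
  have hSr : ∀ j, Var[Y; P] * S (Sum.inr j) = z j := by
    intro j
    rw [hS, Finset.sum_range]
    simp only [PiLp.smul_apply, WithLp.ofLp_sum, Finset.sum_apply, influence_inr, smul_eq_mul,
      ← Finset.mul_sum, hz]
    field_simp
  have hSl : ∀ j, S (Sum.inl j) = ∑ k, (covX P X)⁻¹ j k * z k := by
    intro j
    rw [hS, Finset.sum_range]
    simp only [PiLp.smul_apply, WithLp.ofLp_sum, Finset.sum_apply, influence_inl, smul_eq_mul, hz]
    rw [Finset.sum_comm, Finset.mul_sum]
    refine Finset.sum_congr rfl fun k _ => ?_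
    rw [← Finset.mul_sum]
    ring
  -- Empirical covariances are unchanged by centering at the true means; what remains beside `z` is
  -- the product of the centered empirical means.
  have hcov : ∀ j, √n * empCov (sampleVec Ys n ω).ofLp (sampleVec (fun i => Xs i j) n ω).ofLp =
      z j - meanRemainder P Y X Ys Xs n ω j := by
    intro j
    rw [← empCov_sub_const _ _ P[Y] P[X j]]
    simp only [empCov, sampleVec, meanRemainder, hz, mul_sub (√n)]
    congr 1
    rw [← mul_assoc, ← div_eq_mul_inv, Real.sqrt_div_self]
    simp only [mul_comm]
  have hsq : (n : ℝ) = √n * √n := (Real.mul_self_sqrt hn'.le).symm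
  rw [sampleR2, empR2, empVar_starProjection hn _ _ hM]
  -- The left half of `S` is `M₀⁻¹ z` and the right half is `z / Var(Y)`; hence the first and third
  -- sums of `statMap` cancel.
  have hquad : ∑ j, S (Sum.inl j) * S (Sum.inr j) = ∑ j, ∑ k, Var[Y; P] * S (Sum.inr j) *
      ((covX P X)⁻¹ j k * S (Sum.inr k)) := by
    refine Finset.sum_congr rfl fun j _ => ?_
    rw [hSl, Finset.sum_mul]
    refine Finset.sum_congr rfl fun k _ => ?_
    rw [← hSr]
    ring
  unfold statMap
  simp only
  rw [hquad, add_sub_cancel_left]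
  simp only [hSr, ← hcov, dotProduct, Matrix.mulVec, Finset.mul_sum, Finset.sum_div]
  refine Finset.sum_congr rfl fun j _ => Finset.sum_congr rfl fun k _ => ?_
  rw [empPrecision, hsq]
  rw [Real.sqrt_mul_self (Real.sqrt_nonneg _)]
  ring

theorem tendstoInDistribution_natCast_mul_sampleR2 (hY : MemLp Y 2 P) (hX : ∀ j, MemLp (X j) 2 P)
    (hVar : 0 < Var[Y; P])
    (hindep : iIndepFun (fun i ω => (Ys i ω, fun j => Xs i j ω)) Q)
    (hident : ∀ i, IdentDistrib (fun ω => (Ys i ω, fun j => Xs i j ω))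
      (fun ω => (Y ω, fun j => X j ω)) Q P)
    (hM : IsUnit (covX P X))
    (hmom₁ : ∀ j, Integrable (fun ω => (X j ω - P[X j]) ^ 2 * resY hY hX ω ^ 2) P)
    (hmom₂ : ∀ j, Integrable (fun ω => (Y ω - P[Y]) ^ 2 * resX hY hX j ω ^ 2) P)
    (hR : popR2 hY hX = 0) :
    TendstoInDistribution (fun (n : ℕ) ω => (n : ℝ) * sampleR2 Ys Xs n ω) atTop
      (fun G : EuclideanSpace ℝ (Fin p ⊕ Fin p) => ∑ j, G (Sum.inl j) * G (Sum.inr j))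
      (fun _ => Q) (multivariateGaussian 0 (matBAB hY hX)) := by
  have hYm : ∀ i, AEMeasurable (Ys i) Q := fun i =>
    measurable_fst.comp_aemeasurable (hident i).aemeasurable_fst
  have hXm : ∀ i j, AEMeasurable (Xs i j) Q := fun i j =>
    (measurable_pi_apply j).comp_aemeasurable
      (measurable_snd.comp_aemeasurable (hident i).aemeasurable_fst)
  have hKm := aemeasurable_empPrecision hYm hXm
  have hDm : ∀ n, AEMeasurable (meanRemainder P Y X Ys Xs n) Q := fun n => by
    refine aemeasurable_pi_lambda _ fun j => ?_
    unfold meanRemainder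
    fun_prop
  have hK : TendstoInMeasure Q (empPrecision Ys Xs) atTop
      fun _ j k => (covX P X)⁻¹ j k / Var[Y; P] :=
    tendstoInMeasure_of_tendsto_ae (fun n => (hKm n).aestronglyMeasurable)
      (tendsto_empPrecision_ae hY hX hVar hM hindep hident)
  have h₁ := (tendstoInDistribution_sum_influence hY hX hVar hindep hident hmom₁ hmom₂
    hR).prodMk_of_tendstoInMeasure_const _ _ _ hK hKm
  have h₂ := h₁.continuous_comp_prodMk_of_tendstoInMeasure_const
    (continuous_statMap Var[Y; P] (covX P X)⁻¹)
    (tendstoInMeasure_meanRemainder hY hX hindep hident) hDm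
  simp only [id, statMap_limit hVar.ne'] at h₂
  have hmeas : ∀ n : ℕ, AEMeasurable (fun ω => (n : ℝ) * sampleR2 Ys Xs n ω) Q :=
    fun n => (aemeasurable_sampleR2 hident n).const_mul _
  -- The exact formula needs `Mₙ` invertible. Almost surely this holds for all large `n`, so the
  -- difference is eventually zero.
  refine tendstoInDistribution_of_tendstoInMeasure_sub _ _ h₂ ?_ hmeas
  refine tendstoInMeasure_of_tendsto_ae
    (fun n => ((hmeas n).sub (h₂.forall_aemeasurable n)).aestronglyMeasurable) ?_
  filter_upwards [tendsto_empCov_sampleVec_ae hX hindep hident] with ω hω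
  refine tendsto_const_nhds.congr' ?_
  filter_upwards [eventually_isUnit_of_tendsto hω hM, eventually_gt_atTop 0] with n h₁ h₂
  simp only [Pi.zero_apply, Pi.sub_apply]
  rw [natCast_mul_sampleR2_eq_statMap (X := X) hVar h₂ h₁, sub_self]

end Sample

/-! ### The three cases of the theorem -/

theorem lemma3p2 {Ω Ω' : Type*} [MeasurableSpace Ω] [MeasurableSpace Ω']
    (P : Measure Ω) [IsProbabilityMeasure P] (Q : Measure Ω') [IsProbabilityMeasure Q]
    (p : ℕ)
    -- the vector `(Y, X 1, …, X p)`, square integrable, with `Var Y > 0`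
    (Y : Ω → ℝ) (X : Fin p → Ω → ℝ)
    (hY : MemLp Y 2 P) (hX : ∀ j, MemLp (X j) 2 P) (hVar : 0 < Var[Y; P])
    -- independent copies of it
    (Ys : ℕ → Ω' → ℝ) (Xs : ℕ → Fin p → Ω' → ℝ)
    (hindep : iIndepFun (fun i ω => (Ys i ω, fun j => Xs i j ω)) Q)
    (hident : ∀ i, IdentDistrib (fun ω => (Ys i ω, fun j => Xs i j ω))
      (fun ω => (Y ω, fun j => X j ω)) Q P)
    (hM : IsUnit (covX P X))
    (hmom₁ : ∀ j, Integrable (fun ω => (X j ω - P[X j]) ^ 2 * resY hY hX ω ^ 2) P)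
    (hmom₂ : ∀ j, Integrable (fun ω => (Y ω - P[Y]) ^ 2 * resX hY hX j ω ^ 2) P) :
    (popR2 hY hX = 1 →
      (∀ᵐ ω ∂Q, (∀ n, 0 < empVar (sampleVec Ys n ω) → sampleR2 Ys Xs n ω = 1) ∧
        ∀ᶠ n in atTop, 0 < empVar (sampleVec Ys n ω) ∧ sampleR2 Ys Xs n ω = 1) ∧
      asymVar hY hX = 0) ∧
    (popR2 hY hX = 0 →
      asymVar hY hX = 0 ∧
      (matBAB hY hX).PosSemidef ∧
      TendstoInDistribution (fun (n : ℕ) ω => (n : ℝ) * sampleR2 Ys Xs n ω) atTop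
        (fun G : EuclideanSpace ℝ (Fin p ⊕ Fin p) => ∑ j, G (Sum.inl j) * G (Sum.inr j))
        (fun _ => Q) (multivariateGaussian 0 (matBAB hY hX))) ∧
    (0 < popR2 hY hX → LinIndepAS P (centeredProducts P Y X) → 0 < asymVar hY hX) := by
  refine ⟨fun hR => ⟨?_, ?_⟩, fun hR => ⟨?_, ?_, ?_⟩, fun hR hind => ?_⟩
  · filter_upwards [sampleR2_eq_one_ae hY hX hVar hident hR,
      tendsto_empVar_sampleVec_ae hY hindep hident] with ω h₁ h₂
    refine ⟨h₁, ?_⟩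
    filter_upwards [h₂.eventually_const_lt hVar] with n hn
    exact ⟨hn, h₁ n hn⟩
  · rw [asymVar_eq_zero_iff hY hX hmom₁ hmom₂ hVar hM]
    filter_upwards [explained_ae_of_popR2_eq_one hY hX hVar hR] with ω hω
    rw [hω, hR]
    ring
  · rw [asymVar_eq_zero_iff hY hX hmom₁ hmom₂ hVar hM]
    filter_upwards [explained_ae_of_popR2_eq_zero hY hX hVar hR] with ω hω
    rw [hω, hR, Pi.zero_apply]
    ring
  · exact posSemidef_matBAB hY hX hmom₁ hmom₂
  · exact tendstoInDistribution_natCast_mul_sampleR2 hY hX hVar hindep hident hM hmom₁ hmom₂ hR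
  · exact asymVar_pos hY hX hmom₁ hmom₂ hVar hM hR hind
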